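/- Let $\mathcal B$ be a finite alphabet and let $X\subseteq\mathcal B^{\mathbb Z}$ be a non-empty minimal subshift with shift map $S$. Then the topological rank of $(X,S)$ is at most $K(X)^2$, where $$K(X)=\lim_{n\to+\infty}\ \inf\Big\{|\mathcal W| \ :\ \mathcal W\subset\bigcup_{k\ge n}\mathcal L_k(X)\ \text{finite},\ \mathcal W\text{ recognizable in }X\Big\}\in\mathbb N\cup\{+\infty\}.$$ Here $\mathcal L_k(X)$ is the set of words of length $k$ that occur in points of $X$, and $\inf\emptyset=+\infty$. A finite set $\mathcal W$ of non-empty words over $\mathcal B$ is *recognizable in $X$* if there are a finite alphabet $\mathcal A$, a subshift $Y\subseteq\mathcal A^{\mathbb Z}$ and a morphism $\tau:\mathcal A^*\to\mathcal B^*$ with $\tau(\mathcal A)=\mathcal W$ such that $X=\bigcup_{k\in\mathbb Z}S^k\tau(Y)$ and every $x\in\mathcal B^{\mathbb Z}$ can be written in at most one way as $x=S^k\tau(y)$ with $y\in Y$ and $0\le k<|\tau(y_0)|$. The *topological rank* of a system $(X,T)$ is the least integer $d$ such that $(X,T)$ is topologically conjugate to the Bratteli–Vershik system $(X_B,V_B)$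 of some simple, properly ordered Bratteli diagram $B$ with at most $d$ vertices on each level; it is $+\infty$ if there is no such $d$. (If $X$ is finite then $K(X)=+\infty$ and the bound is void, so that the statement concerns infinite $X$, i.e. minimal Cantor systems.) -/

import Mathlib

open SymbolicDynamics.FullShift

namespace TopRank

/-! ### Topological dynamical systems and subshifts -/

/-- A homeomorphism `T` of `X` is minimal if every two-sided orbit is dense. -/
def IsMinimalSystem {X : Type*} [TopologicalSpace X] (T : X ≃ₜ X) : Prop :=
  ∀ x : X, Dense (Set.range fun n : ℤ => (T ^ n) x)

/-- The shift map `(x_n) ↦ (x_{n+1})` as a homeomorphism of a two-sided subshift. -/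
def shiftHomeo {B : Type*} [TopologicalSpace B] (X : Subshift B ℤ) :
    X.carrier ≃ₜ X.carrier where
  toFun x := ⟨shift 1 x.1, X.mapsTo 1 x.2⟩
  invFun x := ⟨shift (-1) x.1, X.mapsTo (-1) x.2⟩
  left_inv x := by
    apply Subtype.ext
    funext i
    simp [shift_apply]
  right_inv x := by
    apply Subtype.ext
    funext i
    simp [shift_apply]
  continuous_toFun :=
    ((continuous_shift (1 : ℤ)).comp continuous_subtype_val).subtype_mk _
  continuous_invFun :=
    ((continuous_shift (-1 : ℤ)).comp continuous_subtype_val).subtype_mk _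

/-- The word `x_{[m, m + ℓ)}`. -/
def wordAt {B : Type*} (x : ℤ → B) (m : ℤ) (ℓ : ℕ) : List B :=
  List.ofFn fun i : Fin ℓ => x (m + (i : ℤ))

/-- `L_ℓ(X)`: the words of length `ℓ` that occur in points of `X`. -/
def languageOfLength {B : Type*} [TopologicalSpace B] (X : Subshift B ℤ) (ℓ : ℕ) :
    Set (List B) :=
  {w | ∃ x ∈ X.carrier, ∃ m : ℤ, w = wordAt x m ℓ}

/-! ### Morphisms and recognizability

A morphism from the free monoid on `A` to the free monoid on `B` is given by the images
`τ a : List B` of the letters. -/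

/-- The starting position of `τ (y_n)` in `τ (y)`, where the position of `τ (y_0)` is `0`. -/
noncomputable def cut {A B : Type*} (τ : A → List B) (y : ℤ → A) (n : ℤ) : ℤ :=
  ∑ j ∈ Finset.Ico 0 n, ((τ (y j)).length : ℤ) - ∑ j ∈ Finset.Ico n 0, ((τ (y j)).length : ℤ)

/-- `z = τ (y)`: the two-sided sequence `z` is the concatenation
`⋯ τ (y_{-2}) τ (y_{-1}) . τ (y_0) τ (y_1) ⋯`, with `τ (y_0)` starting at coordinate `0`. -/
def IsImage {A B : Type*} (τ : A → List B) (y : ℤ → A) (z : ℤ → B) : Prop :=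
  ∀ (n : ℤ) (i : ℕ) (hi : i < (τ (y n)).length), z (cut τ y n + i) = (τ (y n))[i]

theorem cut_zero {A B : Type*} (τ : A → List B) (y : ℤ → A) : cut τ y 0 = 0 := by
  simp [cut]

theorem cut_succ {A B : Type*} (τ : A → List B) (y : ℤ → A) (n : ℤ) :
    cut τ y (n + 1) = cut τ y n + (τ (y n)).length := by
  unfold cut
  rcases le_or_gt 0 n with h | h
  · have h1 : Finset.Ico (n + 1) 0 = ∅ := Finset.Ico_eq_empty (by omega)
    have h2 : Finset.Ico n 0 = ∅ := Finset.Ico_eq_empty (by omega)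
    have h3 : Finset.Ico 0 (n + 1) = insert n (Finset.Ico 0 n) := by
      ext j; simp only [Finset.mem_Ico, Finset.mem_insert]; omega
    rw [h1, h2, h3, Finset.sum_insert (by simp)]
    simp only [Finset.sum_empty]; ring
  · have h1 : Finset.Ico 0 (n + 1) = ∅ := Finset.Ico_eq_empty (by omega)
    have h2 : Finset.Ico 0 n = ∅ := Finset.Ico_eq_empty (by omega)
    have h3 : Finset.Ico n 0 = insert n (Finset.Ico (n + 1) 0) := by
      ext j; simp only [Finset.mem_Ico, Finset.mem_insert]; omega
    rw [h1, h2, h3, Finset.sum_insert (by simp)]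
    simp only [Finset.sum_empty]; ring

/-- For a non-erasing `τ`, every two-sided sequence `y` has exactly one image `τ (y)`. -/
theorem existsUnique_isImage {A B : Type*} (τ : A → List B) (hτ : ∀ a, τ a ≠ [])
    (y : ℤ → A) : ∃! z, IsImage τ y z := by
  have hpos : ∀ n, (1 : ℤ) ≤ (τ (y n)).length := fun n => by
    have := List.length_pos_iff.2 (hτ (y n)); omega
  have hmono : StrictMono (cut τ y) := strictMono_int_of_lt_succ fun n => by
    rw [cut_succ]; have := hpos n; omega
  have hup : ∀ n : ℕ, (n : ℤ) ≤ cut τ y n := fun n => by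
    induction n with
    | zero => simp [cut_zero]
    | succ k ih => push_cast; rw [cut_succ]; have := hpos k; omega
  have hdown : ∀ n : ℕ, cut τ y (-n) ≤ -n := fun n => by
    induction n with
    | zero => simp [cut_zero]
    | succ k ih =>
      have h := cut_succ τ y (-((k + 1 : ℕ) : ℤ))
      have h' : -((k + 1 : ℕ) : ℤ) + 1 = -(k : ℤ) := by push_cast; ring
      rw [h'] at h
      have := hpos (-((k + 1 : ℕ) : ℤ))
      push_cast at *; omega
  have hfind : ∀ i : ℤ, ∃ n, ∃ j : ℕ, j < (τ (y n)).length ∧ cut τ y n + j = i := fun i => by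
    obtain ⟨n, hn, hmax⟩ := Int.exists_greatest_of_bdd (P := fun n => cut τ y n ≤ i)
      ⟨|i| + 1, fun n hn => by
        by_contra hlt
        have h1 := hmono (not_le.1 hlt)
        have h2 := hup (|i| + 1).toNat
        rw [Int.toNat_of_nonneg (by positivity)] at h2
        have := le_abs_self i
        omega⟩
      ⟨-(i.natAbs : ℤ), by have := hdown i.natAbs; omega⟩
    have h1 : i < cut τ y (n + 1) := by
      by_contra hlt
      have := hmax (n + 1) (not_lt.1 hlt); omega
    rw [cut_succ] at h1
    exact ⟨n, (i - cut τ y n).toNat, by omega, by omega⟩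
  have huniq : ∀ n m : ℤ, ∀ i j : ℕ, i < (τ (y n)).length → j < (τ (y m)).length →
      cut τ y n + i = cut τ y m + j → n = m := fun n m i j hi hj h => by
    rcases lt_trichotomy n m with hlt | heq | hlt
    · have := hmono.monotone (Int.add_one_le_iff.2 hlt); rw [cut_succ] at this; omega
    · exact heq
    · have := hmono.monotone (Int.add_one_le_iff.2 hlt); rw [cut_succ] at this; omega
  choose N J hJ hNJ using hfind
  refine ⟨fun i => (τ (y (N i)))[J i]'(hJ i), ?_, ?_⟩
  · intro n i hi
    have hn := huniq _ _ _ _ (hJ (cut τ y n + i)) hi (hNJ _)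
    have hj := hNJ (cut τ y n + i)
    rw [hn] at hj
    have hj' : J (cut τ y n + i) = i := by omega
    simp only [hn, hj']
  · intro z hz
    funext i
    have := hz (N i) (J i) (hJ i)
    rw [hNJ] at this
    exact this

/-- `(k, y)` is a `τ`-representation of `x`: `x = S^k τ(y)`. -/
def IsRepresentation {A B : Type*} (τ : A → List B) (k : ℤ) (y : ℤ → A) (x : ℤ → B) : Prop :=
  ∃ z, IsImage τ y z ∧ x = shift k z

/-- `(k, y)` is a centered `τ`-representation of `x`: moreover `0 ≤ k < |τ(y_0)|`. -/
def IsCenteredRepresentation {A B : Type*} (τ : A → List B) (k : ℤ) (y : ℤ → A)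
    (x : ℤ → B) : Prop :=
  IsRepresentation τ k y x ∧ 0 ≤ k ∧ k < (τ (y 0)).length

/-- `τ` is recognizable in `Y`: every two-sided sequence has at most one centered
`τ`-representation in `Y`. -/
def IsRecognizableMorphism {A B : Type*} [TopologicalSpace A] (τ : A → List B)
    (Y : Subshift A ℤ) : Prop :=
  ∀ (x : ℤ → B) (k k' : ℤ), ∀ y ∈ Y.carrier, ∀ y' ∈ Y.carrier,
    IsCenteredRepresentation τ k y x → IsCenteredRepresentation τ k' y' x → k = k' ∧ y = y'

/-- The finite set `W` of non-empty words is recognizable in `X` with respect to `(Y, τ)`. -/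
structure IsRecognizableWith {A B : Type*} [TopologicalSpace A] [TopologicalSpace B]
    (W : Finset (List B)) (X : Subshift B ℤ) (Y : Subshift A ℤ) (τ : A → List B) : Prop where
  nonempty_words : ∀ w ∈ W, w ≠ []
  range_eq : Set.range τ = (W : Set (List B))
  /-- `X = ⋃ k, S^k (τ(Y))`, the smallest subshift containing `τ(Y)`. -/
  carrier_eq : X.carrier = {x | ∃ (k : ℤ) (y : ℤ → A), y ∈ Y.carrier ∧ IsRepresentation τ k y x}
  recognizable : IsRecognizableMorphism τ Y

/-- `W` is recognizable in `X`: it is so with respect to some subshift `Y` over a finite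
alphabet and some morphism `τ`. -/
def IsRecognizable {B : Type*} [TopologicalSpace B]
    (W : Finset (List B)) (X : Subshift B ℤ) : Prop :=
  ∃ (A : Type) (_ : Finite A) (_ : TopologicalSpace A) (_ : DiscreteTopology A)
    (Y : Subshift A ℤ) (τ : A → List B), IsRecognizableWith W X Y τ

/-- The least cardinality of a set of words of length at least `n` of the language of `X`
that is recognizable in `X` (`⊤` if there is none). -/
noncomputable def minRecognizable {B : Type*} [TopologicalSpace B] (X : Subshift B ℤ)
    (n : ℕ) : ℕ∞ :=
  sInf {c | ∃ W : Finset (List B), (W : Set (List B)) ⊆ ⋃ k ≥ n, languageOfLength X k ∧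
    IsRecognizable W X ∧ c = (W.card : ℕ∞)}

theorem monotone_minRecognizable {B : Type*} [TopologicalSpace B] (X : Subshift B ℤ) :
    Monotone (minRecognizable X) := by
  intro m n hmn
  apply sInf_le_sInf
  rintro c ⟨W, hW, h⟩
  refine ⟨W, hW.trans ?_, h⟩
  exact Set.biUnion_subset_biUnion_left fun k hk => le_trans hmn hk

/-- `K(X) = lim_n minRecognizable X n`; the sequence is nondecreasing, so that the limit is
its supremum. -/
noncomputable def K {B : Type*} [TopologicalSpace B] (X : Subshift B ℤ) : ℕ∞ :=
  ⨆ n, minRecognizable X n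

theorem tendsto_minRecognizable {B : Type*} [TopologicalSpace B] (X : Subshift B ℤ) :
    Filter.Tendsto (minRecognizable X) Filter.atTop (nhds (K X)) :=
  tendsto_atTop_iSup (monotone_minRecognizable X)

/-! ### Bratteli-Vershik systems -/

/-- An ordered Bratteli diagram. The edges in `E n` join `V n` to `V (n + 1)`. Two edges are
comparable if and only if they have the same range. -/
structure OrderedBratteliDiagram where
  V : ℕ → Type
  E : ℕ → Type
  [finite_V : ∀ n, Finite (V n)]
  [finite_E : ∀ n, Finite (E n)]
  root : V 0
  eq_root : ∀ v : V 0, v = root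
  s : ∀ {n}, E n → V n
  r : ∀ {n}, E n → V (n + 1)
  s_surjective : ∀ n, Function.Surjective (s (n := n))
  r_surjective : ∀ n, Function.Surjective (r (n := n))
  [order : ∀ n, PartialOrder (E n)]
  comparable_iff : ∀ {n} (e f : E n), (e ≤ f ∨ f ≤ e) ↔ r e = r f

namespace OrderedBratteliDiagram

attribute [instance] finite_V finite_E order

variable (D : OrderedBratteliDiagram)

/-- `D.Reaches u m v`: a finite path leads from the vertex `u` to the vertex `v` of level `m`. -/
inductive Reaches {n : ℕ} (u : D.V n) : ∀ m : ℕ, D.V m → Prop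
  | refl : Reaches u n u
  | step {m : ℕ} (e : D.E m) : Reaches u m (D.s e) → Reaches u (m + 1) (D.r e)

/-- Simple diagrams: for every `n ≥ 1` there is `N > n` such that every vertex of level `n` is
connected to every vertex of level `N`. -/
def IsSimple : Prop :=
  ∀ n ≥ 1, ∃ N > n, ∀ (u : D.V n) (v : D.V N), D.Reaches u N v

/-- The space `X_D` of infinite paths (all of them start at the root). -/
def Path : Type :=
  {x : ∀ n, D.E n // ∀ n, D.r (x n) = D.s (x (n + 1))}

/-- The cylinder sets form a basis: the topology induced by the product of the discrete
topologies on the sets of edges. -/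
instance : TopologicalSpace D.Path :=
  TopologicalSpace.induced Subtype.val (@Pi.topologicalSpace ℕ D.E fun _ => ⊥)

/-- All edges of the path are maximal (for the order on the edges with the same range). -/
def IsMaxPath (x : D.Path) : Prop := ∀ n, IsMax (x.1 n)

/-- All edges of the path are minimal (for the order on the edges with the same range). -/
def IsMinPath (x : D.Path) : Prop := ∀ n, IsMin (x.1 n)

/-- Properly ordered: there are a unique maximal and a unique minimal infinite path. -/
def IsProperlyOrdered : Prop :=
  (∃! x, D.IsMaxPath x) ∧ ∃! x, D.IsMinPath x

/-- The graph of the Vershik map. The maximal path goes to the minimal path. For any other path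
`x`, if `n` is the first index for which `x n` is not maximal, then `y n` is the successor of
`x n`, the edges of `y` before `n` are minimal and the edges after `n` are those of `x`. -/
def IsVershikImage (x y : D.Path) : Prop :=
  (D.IsMaxPath x ∧ D.IsMinPath y) ∨
    ∃ n, (∀ m < n, IsMax (x.1 m)) ∧ x.1 n ⋖ y.1 n ∧ (∀ m < n, IsMin (y.1 m)) ∧
      ∀ m > n, y.1 m = x.1 m

variable {D}

theorem r_eq_of_le {n : ℕ} {e f : D.E n} (h : e ≤ f) : D.r e = D.r f :=
  (D.comparable_iff e f).1 (Or.inl h)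

theorem exists_isMin (n : ℕ) (v : D.V (n + 1)) : ∃ e : D.E n, D.r e = v ∧ IsMin e := by
  obtain ⟨e, he, hmin⟩ := (Set.toFinite {e : D.E n | D.r e = v}).exists_minimal
    (D.r_surjective n v)
  exact ⟨e, he, fun f hf => hmin ((r_eq_of_le hf).trans he) hf⟩

theorem isMin_unique {n : ℕ} {e f : D.E n} (he : IsMin e) (hf : IsMin f)
    (h : D.r e = D.r f) : e = f := by
  rcases (D.comparable_iff e f).2 h with h | h
  · exact le_antisymm h (hf h)
  · exact le_antisymm (he h) h

theorem exists_minimal_extension (n : ℕ) (z : ∀ m, D.E m)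
    (hz : ∀ m ≥ n, D.r (z m) = D.s (z (m + 1))) :
    ∃ y : D.Path, (∀ m ≥ n, y.1 m = z m) ∧ ∀ m < n, IsMin (y.1 m) := by
  induction n generalizing z with
  | zero => exact ⟨⟨z, fun m => hz m (Nat.zero_le m)⟩, fun m _ => rfl, fun m hm => by omega⟩
  | succ n ih =>
    obtain ⟨f, hf, hmin⟩ := exists_isMin n (D.s (z (n + 1)))
    obtain ⟨y, hy, hy'⟩ := ih (Function.update z n f) fun m hm => by
      rcases Nat.eq_or_lt_of_le hm with rfl | hlt
      · simp [hf]
      · rw [Function.update_of_ne (by omega), Function.update_of_ne (by omega)]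
        exact hz m hlt
    refine ⟨y, fun m hm => ?_, fun m hm => ?_⟩
    · rw [hy m (by omega), Function.update_of_ne (by omega)]
    · rcases Nat.eq_or_lt_of_le (Nat.lt_succ_iff.1 hm) with rfl | hlt
      · rw [hy m le_rfl]; simpa using hmin
      · exact hy' m hlt

theorem eq_of_minimal {x y : D.Path} (n : ℕ) (h : ∀ m ≥ n, x.1 m = y.1 m)
    (hx : ∀ m < n, IsMin (x.1 m)) (hy : ∀ m < n, IsMin (y.1 m)) : x = y := by
  induction n with
  | zero => exact Subtype.ext (funext fun m => h m (Nat.zero_le m))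
  | succ n ih =>
    refine ih (fun m hm => ?_) (fun m hm => hx m (by omega)) (fun m hm => hy m (by omega))
    rcases Nat.eq_or_lt_of_le hm with rfl | hlt
    · refine isMin_unique (hx _ (by omega)) (hy _ (by omega)) ?_
      rw [x.2, y.2, h _ le_rfl]
    · exact h m hlt

theorem exists_covBy {n : ℕ} {e : D.E n} (he : ¬ IsMax e) : ∃ f, e ⋖ f := by
  obtain ⟨g, hg⟩ := not_isMax_iff.1 he
  obtain ⟨f, hf, hmin⟩ := (Set.toFinite {f : D.E n | e < f}).exists_minimal ⟨g, hg⟩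
  exact ⟨f, hf, fun c hc hcf => absurd (hmin hc hcf.le) hcf.not_ge⟩

theorem covBy_unique {n : ℕ} {e f g : D.E n} (hf : e ⋖ f) (hg : e ⋖ g) : f = g := by
  rcases (D.comparable_iff f g).2
    ((r_eq_of_le hf.le).symm.trans (r_eq_of_le hg.le)) with h | h
  · exact (hg.eq_or_eq hf.le h).resolve_left hf.ne'
  · exact ((hf.eq_or_eq hg.le h).resolve_left hg.ne').symm

/-- On a properly ordered diagram, every path has exactly one image. -/
theorem existsUnique_isVershikImage (hD : D.IsProperlyOrdered) (x : D.Path) :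
    ∃! y, D.IsVershikImage x y := by
  classical
  by_cases hx : D.IsMaxPath x
  · obtain ⟨y, hy, huniq⟩ := hD.2
    refine ⟨y, Or.inl ⟨hx, hy⟩, ?_⟩
    rintro z (⟨-, hz⟩ | ⟨n, -, hn, -⟩)
    · exact huniq z hz
    · exact absurd (hx n) (not_isMax_iff.2 ⟨_, hn.lt⟩)
  · have hex : ∃ n, ¬ IsMax (x.1 n) := not_forall.1 hx
    have hN : ¬ IsMax (x.1 (Nat.find hex)) := Nat.find_spec hex
    have hlt : ∀ m < Nat.find hex, IsMax (x.1 m) := fun m hm => not_not.1 (Nat.find_min hex hm)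
    generalize Nat.find hex = N at hN hlt
    obtain ⟨f, hf⟩ := exists_covBy hN
    obtain ⟨y, hy, hy'⟩ := exists_minimal_extension N (Function.update x.1 N f) fun m hm => by
      rcases Nat.eq_or_lt_of_le hm with rfl | hlt
      · rw [Function.update_self, Function.update_of_ne (by omega),
          ← r_eq_of_le hf.le]
        exact x.2 _
      · rw [Function.update_of_ne (by omega), Function.update_of_ne (by omega)]
        exact x.2 m
    have hyN : y.1 N = f := by rw [hy N le_rfl, Function.update_self]
    have hygt : ∀ m > N, y.1 m = x.1 m := fun m hm => by
      rw [hy m (by omega), Function.update_of_ne (by omega)]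
    refine ⟨y, Or.inr ⟨N, hlt, hyN ▸ hf, hy', hygt⟩, ?_⟩
    rintro z (⟨hmax, -⟩ | ⟨n, h1, h2, h3, h4⟩)
    · exact absurd hmax hx
    · have hn : n = N := by
        rcases lt_trichotomy n N with h | h | h
        · exact absurd (hlt n h) (not_isMax_iff.2 ⟨_, h2.lt⟩)
        · exact h
        · exact absurd (h1 N h) hN
      subst hn
      refine eq_of_minimal n (fun m hm => ?_) h3 hy'
      rcases Nat.eq_or_lt_of_le hm with rfl | hlt
      · rw [hyN]; exact covBy_unique h2 hf
      · rw [h4 m hlt, hygt m hlt]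

/-- The Vershik map of a properly ordered Bratteli diagram. -/
noncomputable def vershikMap (hD : D.IsProperlyOrdered) (x : D.Path) : D.Path :=
  (existsUnique_isVershikImage hD x).choose

theorem isVershikImage_vershikMap (hD : D.IsProperlyOrdered) (x : D.Path) :
    D.IsVershikImage x (vershikMap hD x) :=
  (existsUnique_isVershikImage hD x).choose_spec.1

/-- `D` is a Bratteli-Vershik representation of `(X, T)`: it is simple and properly ordered,
and `(X_D, V_D)` is topologically conjugate to `(X, T)`. -/
def IsRepresentationOf (D : OrderedBratteliDiagram) {X : Type*} [TopologicalSpace X]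
    (T : X ≃ₜ X) : Prop :=
  D.IsSimple ∧ ∃ hD : D.IsProperlyOrdered, ∃ φ : D.Path ≃ₜ X,
    ∀ x, φ (vershikMap hD x) = T (φ x)

end OrderedBratteliDiagram

/-- The topological rank of `(X, T)`: the least `d` for which there is a Bratteli-Vershik
representation with at most `d` vertices on every level (`⊤` if there is none). -/
noncomputable def topologicalRank {X : Type*} [TopologicalSpace X] (T : X ≃ₜ X) : ℕ∞ :=
  sInf {c | ∃ d : ℕ, c = (d : ℕ∞) ∧ ∃ D : OrderedBratteliDiagram,
    D.IsRepresentationOf T ∧ ∀ n, Nat.card (D.V n) ≤ d}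

end TopRank

/-! A recognizable set `W` cuts every point of `X` into words of `W` in a unique way. By compactness
the cutting is locally constant, so it is a partition of `X` into clopen towers indexed by `W`, with
word lengths as heights, whose floors determine the coordinate `x 0`
(`IsRecognizableWith.exists_towerPartition`). If `K X = k` is finite, there are such partitions with
at most `k` towers and arbitrarily large heights.

These partitions need not be nested, and their bases need not shrink to a point. To refine a given
partition `P`, fix `x₀` in its base and let `C` be the clopen set of points `x` such that `x` and
`T⁻¹ x` lie on the same floors of `P` as `x₀` and `T⁻¹ x₀`. By minimality `C` is visited within
bounded time, so each sufficiently tall word tower has a floor inside `C`, far from both ends.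
Cutting every tower there and regluing (`TowerPartition.recut`) gives towers that run from the cut
of one word to the cut of the next: they are indexed by pairs of words, whence the bound `k ^ 2`.
The new base lies in `C` and the new tops in `T⁻¹ C`, hence each lies in a single tower of `P`. As
the cuts are far from the ends, a new floor determines a long window of coordinates, so the new
partition refines `P` and separates more points (`exists_refines`).

Iteration gives a nested sequence of tower partitions. Its diagram has the towers as vertices and
the visits of a tower to the bases of the previous level as edges, ordered by height. The conditions
on bases and tops give unique minimal and maximal paths, tall towers give simplicity, and sending a
point to its path conjugates `T` to the Vershik map (`isRepresentationOf_towerDiagram`). -/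

namespace TopRank

/-! ### Tower partitions -/

/-- A partition of a system `(X, T)` into towers with locally constant data: the point `x` lies on
the floor `pos x` of the tower `tower x`, which has `height (tower x)` floors. -/
structure TowerPartition {X : Type*} [TopologicalSpace X] (T : X ≃ₜ X) (ι : Type*) where
  height : ι → ℕ
  tower : X → ι
  pos : X → ℕ
  pos_lt : ∀ x, pos x < height (tower x)
  tower_locallyConstant : IsLocallyConstant tower
  pos_locallyConstant : IsLocallyConstant pos
  step_tower : ∀ x, pos x + 1 < height (tower x) → tower (T x) = tower x
  step_pos : ∀ x, pos x + 1 < height (tower x) → pos (T x) = pos x + 1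
  step_top : ∀ x, pos x + 1 = height (tower x) → pos (T x) = 0

namespace TowerPartition

variable {X : Type*} [TopologicalSpace X] {T : X ≃ₜ X} {ι : Type*}

/-- The points `x` and `y` lie on the same floor. -/
def SameFloor (P : TowerPartition T ι) (x y : X) : Prop :=
  P.tower x = P.tower y ∧ P.pos x = P.pos y

/-- The point `x` lies on the top floor of its tower. -/
def IsTop (P : TowerPartition T ι) (x : X) : Prop :=
  P.pos x + 1 = P.height (P.tower x)

variable (P : TowerPartition T ι)

theorem isTop_or_lt (x : X) : P.IsTop x ∨ P.pos x + 1 < P.height (P.tower x) := by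
  have := P.pos_lt x
  unfold IsTop
  omega

theorem isTop_of_pos_eq_zero {x : X} (h : P.pos (T x) = 0) : P.IsTop x := by
  rcases P.isTop_or_lt x with h' | h'
  · exact h'
  · have := P.step_pos x h'
    omega

theorem forward (x : X) (i : ℕ) (h : P.pos x + i < P.height (P.tower x)) :
    P.tower ((T ^ (i : ℤ)) x) = P.tower x ∧ P.pos ((T ^ (i : ℤ)) x) = P.pos x + i := by
  induction i with
  | zero => simp
  | succ i ih =>
    obtain ⟨h1, h2⟩ := ih (by omega)
    have e : (T ^ ((i + 1 : ℕ) : ℤ)) x = T ((T ^ (i : ℤ)) x) := by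
      rw [Nat.cast_succ, add_comm, zpow_add, zpow_one]; rfl
    rw [e]
    have h3 : P.pos ((T ^ (i : ℤ)) x) + 1 < P.height (P.tower ((T ^ (i : ℤ)) x)) := by
      rw [h1, h2]; omega
    rw [P.step_tower _ h3, P.step_pos _ h3, h1, h2]
    exact ⟨rfl, rfl⟩

theorem backward (x : X) (i : ℕ) (h : i ≤ P.pos x) :
    P.tower ((T ^ (-(i : ℤ))) x) = P.tower x ∧ P.pos ((T ^ (-(i : ℤ))) x) + i = P.pos x := by
  induction i with
  | zero => simp
  | succ i ih =>
    obtain ⟨h1, h2⟩ := ih (by omega)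
    have e : (T ^ (-(i : ℤ))) x = T ((T ^ (-((i + 1 : ℕ) : ℤ))) x) := by
      conv_rhs => rw [← zpow_one T]
      rw [← Homeomorph.mul_apply, zpow_one, ← zpow_one_add]
      congr 2; push_cast; ring
    generalize (T ^ (-((i + 1 : ℕ) : ℤ))) x = y at *
    rw [e] at h1 h2
    rcases P.isTop_or_lt y with h3 | h3
    · have := P.step_top y h3
      omega
    · have a := P.step_tower y h3
      have b := P.step_pos y h3
      exact ⟨a.symm.trans h1, by omega⟩

theorem exists_base (x : X) : P.tower ((T ^ (-(P.pos x : ℤ))) x) = P.tower x ∧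
    P.pos ((T ^ (-(P.pos x : ℤ))) x) = 0 := by
  obtain ⟨h1, h2⟩ := P.backward x (P.pos x) le_rfl
  exact ⟨h1, by omega⟩

theorem exists_tower_pos {t : ι} (ht : ∃ x, P.tower x = t) {j : ℕ} (hj : j < P.height t) :
    ∃ x, P.tower x = t ∧ P.pos x = j := by
  obtain ⟨x, rfl⟩ := ht
  obtain ⟨h1, h2⟩ := P.exists_base x
  obtain ⟨h3, h4⟩ := P.forward ((T ^ (-(P.pos x : ℤ))) x) j (by rw [h1, h2]; omega)
  exact ⟨_, h3.trans h1, by rw [h4, h2]; omega⟩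

variable {P}

theorem SameFloor.trans {x y z : X} (h : P.SameFloor x y) (h' : P.SameFloor y z) :
    P.SameFloor x z :=
  ⟨h.1.trans h'.1, h.2.trans h'.2⟩

theorem SameFloor.zpow {x y : X} (h : P.SameFloor x y) (i : ℤ) (h0 : 0 ≤ P.pos x + i)
    (h1 : P.pos x + i < P.height (P.tower x)) :
    P.SameFloor ((T ^ i) x) ((T ^ i) y) := by
  obtain ⟨hx, hy⟩ := h
  obtain ⟨n, rfl | rfl⟩ := Int.eq_nat_or_neg i
  · obtain ⟨a, b⟩ := P.forward x n (by omega)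
    obtain ⟨c, d⟩ := P.forward y n (by rw [← hx, ← hy]; omega)
    exact ⟨by rw [a, c, hx], by rw [b, d, hy]⟩
  · obtain ⟨a, b⟩ := P.backward x n (by omega)
    obtain ⟨c, d⟩ := P.backward y n (by omega)
    exact ⟨by rw [a, c, hx], by omega⟩

theorem isClosed_isTop (P : TowerPartition T ι) : IsClosed {x | P.IsTop x} := by
  have : IsLocallyConstant fun x => P.pos x + 1 = P.height (P.tower x) :=
    (P.pos_locallyConstant.prodMk P.tower_locallyConstant).comp
      fun p : ℕ × ι => p.1 + 1 = P.height p.2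
  simpa [IsTop] using (this.isClopen_fiber True).isClosed

theorem isClosed_sameFloor (P : TowerPartition T ι) (y : X) : IsClosed {x | P.SameFloor x y} := by
  exact (P.tower_locallyConstant.isClopen_fiber (P.tower y)).isClosed.inter
    (P.pos_locallyConstant.isClopen_fiber (P.pos y)).isClosed

end TowerPartition

/-! ### Nested sequences of tower partitions -/

/-- The tower partition `Q` is finer than `P`, its base and its top lie in the base and in the top
of a single tower of `P`, and each tower of `Q` visits each tower of `P`. -/
structure TowerPartition.Refines {X : Type*} [TopologicalSpace X] {T : X ≃ₜ X} {ι κ : Type*}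
    (Q : TowerPartition T κ) (P : TowerPartition T ι) : Prop where
  sameFloor : ∀ x y, Q.SameFloor x y → P.SameFloor x y
  pos_eq_zero : ∀ x, Q.pos x = 0 → P.pos x = 0
  base : ∀ x y, Q.pos x = 0 → Q.pos y = 0 → P.tower x = P.tower y
  top : ∀ x y, Q.IsTop x → Q.IsTop y → P.tower x = P.tower y
  meets : ∀ t s, ∃ x, Q.tower x = s ∧ P.tower x = t

/-- A sequence of finer and finer tower partitions that starts with the trivial one and separates
points. -/
structure IsNested {X : Type*} [TopologicalSpace X] {T : X ≃ₜ X} {ι : ℕ → Type}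
    (P : ∀ n, TowerPartition T (ι n)) : Prop where
  tower_surjective : ∀ n, Function.Surjective (P n).tower
  height_zero : ∀ t, (P 0).height t = 1
  subsingleton_zero : Subsingleton (ι 0)
  refines : ∀ n, (P (n + 1)).Refines (P n)
  separates : ∀ x y, (∀ n, (P n).SameFloor x y) → x = y

namespace IsNested

variable {X : Type*} [TopologicalSpace X] {T : X ≃ₜ X} {ι : ℕ → Type}
  {P : ∀ n, TowerPartition T (ι n)}

/-- Going down from `x`, the base of level `n + 1` cannot be reached before that of level `n`, since
the former is contained in the latter. -/
theorem pos_le (h : IsNested P) (n : ℕ) (x : X) : (P n).pos x ≤ (P (n + 1)).pos x := by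
  by_contra! hlt
  have h1 := (h.refines n).pos_eq_zero _ ((P (n + 1)).exists_base x).2
  have h2 := ((P n).backward x _ hlt.le).2
  omega

theorem isTop (h : IsNested P) {n : ℕ} {x : X} (hx : (P (n + 1)).IsTop x) : (P n).IsTop x :=
  (P n).isTop_of_pos_eq_zero ((h.refines n).pos_eq_zero _ ((P (n + 1)).step_top x hx))

theorem isTop_zero (h : IsNested P) (x : X) : (P 0).IsTop x := by
  have := (P 0).pos_lt x
  rw [h.height_zero] at this
  rw [TowerPartition.IsTop, h.height_zero]
  omega

theorem pos_zero (h : IsNested P) (x : X) : (P 0).pos x = 0 := by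
  have := (P 0).pos_lt x
  rw [h.height_zero] at this
  omega

theorem isTop_of_le (h : IsNested P) {m n : ℕ} (hmn : m ≤ n) {x : X} (hx : (P n).IsTop x) :
    (P m).IsTop x := by
  induction n, hmn using Nat.le_induction with
  | base => exact hx
  | succ n _ ih => exact ih (h.isTop hx)

/-- If a floor of the tower of `x` at level `n + 1`, not above the floor of `x`, lies in the base
of level `n`, then it is not above the bottom of the visit of `x` to its tower of level `n`. -/
theorem add_pos_le (h : IsNested P) {n : ℕ} {x z : X}
    (ht : (P (n + 1)).tower z = (P (n + 1)).tower x)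
    (hz : (P n).pos z = 0) (hle : (P (n + 1)).pos z ≤ (P (n + 1)).pos x) :
    (P (n + 1)).pos z + (P n).pos x ≤ (P (n + 1)).pos x := by
  by_contra! hlt
  obtain ⟨i, hi⟩ := Nat.exists_eq_add_of_le hle
  obtain ⟨h1, h2⟩ := (P (n + 1)).backward x i (by omega)
  have h3 := ((h.refines n).sameFloor _ z ⟨h1.trans ht.symm, by omega⟩).2
  have h4 := ((P n).backward x i (by omega)).2
  omega

/-- Tops of level `n + 1` are tops of level `n`, so a tower of level `n + 1` never ends in the
middle of a visit to a tower of level `n`. -/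
theorem pos_add_lt (h : IsNested P) {n : ℕ} {x : X} {i : ℕ}
    (hi : (P n).pos x + i < (P n).height ((P n).tower x)) :
    (P (n + 1)).pos x + i < (P (n + 1)).height ((P (n + 1)).tower x) := by
  by_contra! hle
  have hlt := (P (n + 1)).pos_lt x
  obtain ⟨j, hj⟩ := Nat.exists_eq_add_of_lt hlt
  obtain ⟨h1, h2⟩ := (P (n + 1)).forward x j (by omega)
  have h3 : (P n).IsTop ((T ^ (j : ℤ)) x) := h.isTop (by rw [TowerPartition.IsTop, h1, h2]; omega)
  obtain ⟨h4, h5⟩ := (P n).forward x j (by omega)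
  rw [TowerPartition.IsTop, h4, h5] at h3
  omega

theorem exists_sameFloor [CompactSpace X] (h : IsNested P) (z : ℕ → X)
    (hz : ∀ n, (P n).SameFloor (z (n + 1)) (z n)) : ∃ x, ∀ n, (P n).SameFloor x (z n) := by
  obtain ⟨x, hx⟩ := IsCompact.nonempty_iInter_of_sequence_nonempty_isCompact_isClosed
    (fun n => {x | (P n).SameFloor x (z n)})
    (fun n x hx => ((h.refines n).sameFloor _ _ hx).trans (hz n))
    (fun n => ⟨z n, rfl, rfl⟩) ((P 0).isClosed_sameFloor _).isCompact
    (fun n => (P n).isClosed_sameFloor _)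
  exact ⟨x, fun n => Set.mem_iInter.1 hx n⟩

end IsNested

/-! ### The ordered Bratteli diagram of a nested sequence -/

section Diagram

variable {X : Type*} [TopologicalSpace X] {T : X ≃ₜ X} {ι : ℕ → Type}
  (P : ∀ n, TowerPartition T (ι n))

/-- The edges from level `n` to level `n + 1`: the floor `floor` of the tower `range` of level
`n + 1` lies in the base of the tower `source` of level `n`. -/
structure TowerEdge (n : ℕ) : Type where
  range : ι (n + 1)
  floor : ℕ
  source : ι n
  exists_point : ∃ x, (P (n + 1)).tower x = range ∧ (P (n + 1)).pos x = floor ∧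
    (P n).tower x = source ∧ (P n).pos x = 0

variable {P}

/-- A floor of level `n + 1` lies inside one floor of level `n`, so it determines the source. -/
theorem TowerEdge.eq_of_range_of_floor (h : IsNested P) {n : ℕ} {e f : TowerEdge P n}
    (h1 : e.range = f.range) (h2 : e.floor = f.floor) : e = f := by
  obtain ⟨t, j, s, x, hx1, hx2, hx3, hx4⟩ := e
  obtain ⟨t', j', s', y, hy1, hy2, hy3, hy4⟩ := f
  dsimp only at *
  subst h1 h2
  obtain rfl : s = s' := by
    rw [← hx3, ← hy3]
    exact ((h.refines n).sameFloor x y ⟨hx1.trans hy1.symm, hx2.trans hy2.symm⟩).1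
  rfl

theorem TowerEdge.floor_lt {n : ℕ} (e : TowerEdge P n) :
    e.floor < (P (n + 1)).height e.range := by
  obtain ⟨t, j, s, z, rfl, rfl, -, -⟩ := e
  exact (P (n + 1)).pos_lt z

theorem finite_towerEdge [∀ n, Finite (ι n)] (h : IsNested P) (n : ℕ) :
    Finite (TowerEdge P n) := by
  refine Finite.of_injective (β := Σ t, Fin ((P (n + 1)).height t))
    (fun e => ⟨e.range, e.floor, e.floor_lt⟩) fun e f hef => ?_
  have h1 : e.range = f.range := congrArg Sigma.fst hef
  have h2 := congrArg (fun a => (a.2 : ℕ)) hef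
  exact TowerEdge.eq_of_range_of_floor h h1 h2

/-- The order of the edges with the same range is the order of the floors. -/
@[reducible]
def towerEdgeOrder (h : IsNested P) (n : ℕ) : PartialOrder (TowerEdge P n) where
  le e f := e.range = f.range ∧ e.floor ≤ f.floor
  le_refl e := ⟨rfl, le_rfl⟩
  le_trans e f g h1 h2 := ⟨h1.1.trans h2.1, h1.2.trans h2.2⟩
  le_antisymm e f h1 h2 := TowerEdge.eq_of_range_of_floor h h1.1 (le_antisymm h1.2 h2.2)

variable (P) in
/-- The edge crossed by `x` from level `n` to level `n + 1`. -/
def edgeAt (h : IsNested P) (n : ℕ) (x : X) : TowerEdge P n :=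
  ⟨(P (n + 1)).tower x, (P (n + 1)).pos x - (P n).pos x, (P n).tower x,
    (T ^ (-((P n).pos x : ℤ))) x, by
      obtain ⟨h1, h2⟩ := (P (n + 1)).backward x _ (h.pos_le n x)
      exact ⟨h1, by omega, (P n).exists_base x⟩⟩

/-- Among the visits made by the tower of `x`, the one containing `x` is the last that starts no
higher than `x`. Maximality of edges and the successor relation both reduce to this. -/
theorem le_edgeAt (h : IsNested P) {n : ℕ} {x : X} {e : TowerEdge P n}
    (ht : e.range = (P (n + 1)).tower x) (hle : e.floor ≤ (P (n + 1)).pos x) :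
    (towerEdgeOrder h n).le e (edgeAt P h n x) := by
  obtain ⟨t, j, s, z, hz1, hz2, hz3, hz4⟩ := e
  have := h.add_pos_le (hz1.trans ht) hz4 (hz2.trans_le hle)
  refine ⟨ht, ?_⟩
  dsimp only [edgeAt] at *
  omega

/-- The ordered Bratteli diagram of a nested sequence of tower partitions. -/
noncomputable def towerDiagram [∀ n, Finite (ι n)] [Nonempty X] (h : IsNested P) :
    OrderedBratteliDiagram where
  V := ι
  E := TowerEdge P
  finite_E := finite_towerEdge h
  root := (P 0).tower (Classical.arbitrary X)
  eq_root v := h.subsingleton_zero.elim _ _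
  s e := e.source
  r e := e.range
  s_surjective n v := by
    obtain ⟨x, rfl⟩ := h.tower_surjective n v
    exact ⟨edgeAt P h n x, rfl⟩
  r_surjective n v := by
    obtain ⟨x, rfl⟩ := h.tower_surjective (n + 1) v
    exact ⟨edgeAt P h n x, rfl⟩
  order := towerEdgeOrder h
  comparable_iff e f := by
    constructor
    · rintro (h | h)
      · exact h.1
      · exact h.1.symm
    · intro h
      rcases le_total e.floor f.floor with h' | h'
      · exact Or.inl ⟨h, h'⟩
      · exact Or.inr ⟨h.symm, h'⟩

variable [∀ n, Finite (ι n)] [Nonempty X] (h : IsNested P)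

theorem isSimple_towerDiagram : (towerDiagram h).IsSimple := by
  intro n _
  refine ⟨n + 1, n.lt_succ_self, fun u v => ?_⟩
  obtain ⟨x, rfl, rfl⟩ := (h.refines n).meets u v
  exact OrderedBratteliDiagram.Reaches.step (D := towerDiagram h) (edgeAt P h n x)
    (OrderedBratteliDiagram.Reaches.refl (D := towerDiagram h))

/-! ### The conjugacy between points and paths -/

/-- The infinite path of a point. -/
noncomputable def pathAt (x : X) : (towerDiagram h).Path :=
  ⟨fun n => edgeAt P h n x, fun _ => rfl⟩

theorem isMax_edgeAt {n : ℕ} {x : X} (hx : (P (n + 1)).IsTop x) :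
    IsMax (α := (towerDiagram h).E n) (edgeAt P h n x) := by
  intro e he
  refine le_edgeAt h he.1.symm ?_
  have := TowerEdge.floor_lt e
  have h1 : TowerEdge.range e = (P (n + 1)).tower x := he.1.symm
  rw [h1] at this
  unfold TowerPartition.IsTop at hx
  omega

theorem isTop_of_isMax {n : ℕ} {x : X} (hx : (P n).IsTop x)
    (hm : IsMax (α := (towerDiagram h).E n) (edgeAt P h n x)) : (P (n + 1)).IsTop x := by
  by_contra hn
  have hlt := ((P (n + 1)).isTop_or_lt x).resolve_left hn
  have h0 := (P n).step_top x hx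
  have h1 := (P (n + 1)).step_tower x hlt
  have h2 := (P (n + 1)).step_pos x hlt
  have h3 := hm (b := edgeAt P h n (T x)) ⟨h1.symm, by dsimp only [edgeAt]; omega⟩
  have h4 := h3.2
  dsimp only [edgeAt] at h4
  omega

theorem isMin_edgeAt {n : ℕ} {x : X} (hx : (P (n + 1)).pos x = 0) :
    IsMin (α := (towerDiagram h).E n) (edgeAt P h n x) := by
  intro e he
  refine ⟨he.1.symm, ?_⟩
  dsimp only [edgeAt]
  omega

theorem pos_eq_zero_of_isMin {n : ℕ} {x : X} (hx : (P n).pos x = 0)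
    (hm : IsMin (α := (towerDiagram h).E n) (edgeAt P h n x)) : (P (n + 1)).pos x = 0 := by
  obtain ⟨h1, h2⟩ := (P (n + 1)).exists_base x
  have h3 := hm (b := edgeAt P h n ((T ^ (-((P (n + 1)).pos x : ℤ))) x))
      ⟨h1, by dsimp only [edgeAt]; omega⟩
  have h4 := h3.2
  dsimp only [edgeAt] at h4
  omega

theorem isMaxPath_pathAt_iff {x : X} :
    (towerDiagram h).IsMaxPath (pathAt h x) ↔ ∀ n, (P n).IsTop x := by
  constructor
  · intro hx n
    induction n with
    | zero => exact h.isTop_zero x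
    | succ n ih => exact isTop_of_isMax h ih (hx n)
  · exact fun hx n => isMax_edgeAt h (hx (n + 1))

theorem isMinPath_pathAt_iff {x : X} :
    (towerDiagram h).IsMinPath (pathAt h x) ↔ ∀ n, (P n).pos x = 0 := by
  constructor
  · intro hx n
    induction n with
    | zero => exact h.pos_zero x
    | succ n ih => exact pos_eq_zero_of_isMin h ih (hx n)
  · exact fun hx n => isMin_edgeAt h (hx (n + 1))

/-- The point `x` moves along the Vershik map. -/
theorem isVershikImage_pathAt (x : X) :
    (towerDiagram h).IsVershikImage (pathAt h x) (pathAt h (T x)) := by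
  classical
  by_cases hx : ∀ n, (P n).IsTop x
  · exact Or.inl ⟨(isMaxPath_pathAt_iff h).2 hx,
      (isMinPath_pathAt_iff h).2 fun n => (P n).step_top x (hx n)⟩
  · have hex := not_forall.1 hx
    have hN := Nat.find_spec hex
    have hlt : ∀ m < Nat.find hex, (P m).IsTop x := fun m hm => not_not.1 (Nat.find_min hex hm)
    -- `N` is the first level at which `x` is not on top. It is positive because level `0` has a
    -- single floor, and the edge that changes to its successor is the one from level `N - 1` to
    -- level `N`.
    generalize Nat.find hex = N at hN hlt
    obtain _ | n := N
    · exact absurd (h.isTop_zero x) hN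
    have hl : ∀ m > n, (P m).pos x + 1 < (P m).height ((P m).tower x) := fun m hm =>
      ((P m).isTop_or_lt x).resolve_left fun h' => hN (h.isTop_of_le hm h')
    have h0 := (P n).step_top x (hlt n n.lt_succ_self)
    have h1 := (P (n + 1)).step_tower x (hl _ n.lt_succ_self)
    have h2 := (P (n + 1)).step_pos x (hl _ n.lt_succ_self)
    refine Or.inr ⟨n, fun m hm => isMax_edgeAt h (hlt _ (by omega)), ⟨?_, ?_⟩,
      fun m hm => isMin_edgeAt h ((P (m + 1)).step_top x (hlt _ (by omega))), fun m hm => ?_⟩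
    · refine lt_of_le_not_ge ⟨h1.symm, ?_⟩ fun h' => ?_
      · dsimp only [pathAt, edgeAt]; omega
      · have := h'.2
        dsimp only [pathAt, edgeAt] at this; omega
    -- `T x` starts a new visit one floor above `x`, so an edge strictly below that of `T x` starts
    -- no higher than `x` and is at most the edge of `x`.
    · intro e he he'
      refine he.not_ge (le_edgeAt h he.le.1.symm ?_)
      have : ¬ (P (n + 1)).pos x + 1 ≤ TowerEdge.floor e := fun h' =>
        he'.not_ge ⟨h1.trans he.le.1, by dsimp only [pathAt, edgeAt]; omega⟩
      omega
    · have a := (P m).step_tower x (hl m hm)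
      have b := (P m).step_pos x (hl m hm)
      have c := (P (m + 1)).step_tower x (hl _ (by omega))
      have d := (P (m + 1)).step_pos x (hl _ (by omega))
      refine TowerEdge.eq_of_range_of_floor h c ?_
      dsimp only [pathAt, edgeAt]
      omega

theorem continuous_pathAt : Continuous (pathAt h) := by
  refine continuous_induced_rng.2 ?_
  let _ : ∀ n, TopologicalSpace ((towerDiagram h).E n) := fun _ => ⊥
  refine continuous_pi fun n => IsLocallyConstant.continuous ?_
  refine (IsLocallyConstant.iff_exists_open _).2 fun x => ?_
  have := ((P (n + 1)).tower_locallyConstant.prodMk (P (n + 1)).pos_locallyConstant).prodMk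
    ((P n).pos_locallyConstant)
  obtain ⟨U, hU, hx, hc⟩ := (IsLocallyConstant.iff_exists_open _).1 this x
  refine ⟨U, hU, hx, fun y hy => ?_⟩
  have := hc y hy
  simp only [Prod.mk.injEq] at this
  refine TowerEdge.eq_of_range_of_floor h this.1.1 ?_
  change (P (n + 1)).pos y - (P n).pos y = (P (n + 1)).pos x - (P n).pos x
  omega

instance (D : OrderedBratteliDiagram) : T2Space D.Path := by
  let _ : ∀ n, TopologicalSpace (D.E n) := fun _ => ⊥
  have : ∀ n, DiscreteTopology (D.E n) := fun _ => ⟨rfl⟩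
  exact T2Space.of_injective_continuous (f := (Subtype.val : D.Path → ∀ n, D.E n))
    Subtype.val_injective continuous_induced_dom

/-- The floor of a point at level `n + 1` is its floor at level `n` plus the floor of its edge, so
the path recovers every floor by induction. -/
theorem injective_pathAt : Function.Injective (pathAt h) := by
  intro x y hxy
  have he : ∀ n, edgeAt P h n x = edgeAt P h n y := fun n => congrFun (congrArg Subtype.val hxy) n
  refine h.separates x y fun n => ?_
  induction n with
  | zero => exact ⟨h.subsingleton_zero.elim _ _, by rw [h.pos_zero, h.pos_zero]⟩
  | succ n ih =>
    have h1 := he n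
    simp only [edgeAt, TowerEdge.mk.injEq] at h1
    have h2 := h.pos_le n x
    have h3 := h.pos_le n y
    have h4 := ih.2
    exact ⟨h1.1, by omega⟩

theorem surjective_pathAt [CompactSpace X] : Function.Surjective (pathAt h) := by
  intro p
  let e : ∀ n, TowerEdge P n := p.1
  have he : ∀ n, (e n).range = (e (n + 1)).source := p.2
  -- `o n` is the floor of level `n` prescribed by the path. Each `z n` chosen below lies on the
  -- prescribed floors of levels `n` and `n + 1`, so these floors are nested, and compactness gives
  -- a common point.
  let o : ℕ → ℕ := fun n => ∑ m ∈ Finset.range n, (e m).floor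
  have ho : ∀ n, o (n + 1) = o n + (e n).floor := fun n => Finset.sum_range_succ _ _
  have key : ∀ n, ∃ y, (P n).tower y = (e n).source ∧ (P n).pos y = o n ∧
      (P (n + 1)).tower y = (e n).range ∧ (P (n + 1)).pos y = o (n + 1) := by
    intro n
    have hlt : o n < (P n).height (e n).source := by
      induction n with
      | zero => rw [h.height_zero]; simp [o]
      | succ n ih =>
        obtain ⟨w, hw1, hw2, hw3, hw4⟩ := (e n).exists_point
        have := h.pos_add_lt (x := w) (i := o n) (by rwa [hw3, hw4, zero_add])
        rwa [hw1, hw2, he, add_comm, ← ho] at this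
    obtain ⟨w, hw1, hw2, hw3, hw4⟩ := (e n).exists_point
    have hlt' : (P n).pos w + o n < (P n).height ((P n).tower w) := by rwa [hw3, hw4, zero_add]
    obtain ⟨h1, h2⟩ := (P n).forward w (o n) hlt'
    obtain ⟨h3, h4⟩ := (P (n + 1)).forward w (o n) (h.pos_add_lt hlt')
    have := ho n
    exact ⟨_, h1.trans hw3, by omega, h3.trans hw1, by omega⟩
  choose z hz1 hz2 hz3 hz4 using key
  obtain ⟨x, hx⟩ := h.exists_sameFloor z fun n => (h.refines n).sameFloor _ _
    ⟨by rw [hz1, hz3, he], by rw [hz2, hz4]⟩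
  refine ⟨x, Subtype.ext (funext fun n => ?_)⟩
  refine TowerEdge.eq_of_range_of_floor h (f := e n) ?_ ?_
  · exact (hx (n + 1)).1.trans ((hz1 (n + 1)).trans (he n).symm)
  · have h1 := (hx (n + 1)).2
    have h2 := (hx n).2
    have h3 := ho n
    rw [hz2] at h1 h2
    change (P (n + 1)).pos x - (P n).pos x = _
    omega

theorem isProperlyOrdered_towerDiagram [CompactSpace X] :
    (towerDiagram h).IsProperlyOrdered := by
  constructor
  · obtain ⟨x, hx⟩ := IsCompact.nonempty_iInter_of_sequence_nonempty_isCompact_isClosed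
      (fun n => {x | (P n).IsTop x}) (fun n x hx => h.isTop hx)
      (fun n => by
        have := (P n).pos_lt (Classical.arbitrary X)
        obtain ⟨x, hx, hx'⟩ := (P n).exists_tower_pos ⟨_, rfl⟩ (Nat.sub_one_lt_of_lt this)
        exact ⟨x, by simp only [Set.mem_ofPred_eq, TowerPartition.IsTop, hx, hx']; omega⟩)
      (P 0).isClosed_isTop.isCompact (fun n => (P n).isClosed_isTop)
    rw [Set.mem_iInter] at hx
    refine ⟨pathAt h x, (isMaxPath_pathAt_iff h).2 hx, fun p hp => ?_⟩
    obtain ⟨y, rfl⟩ := surjective_pathAt h p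
    rw [isMaxPath_pathAt_iff] at hp
    rw [h.separates y x fun n => ?_]
    -- Tops of level `n + 1` lie in one tower of level `n`, so two points that are on top at all
    -- levels share every floor.
    have ht := (h.refines n).top y x (hp _) (hx _)
    have h1 : (P n).pos y + 1 = _ := hp n
    have h2 : (P n).pos x + 1 = _ := hx n
    rw [ht] at h1
    exact ⟨ht, by omega⟩
  · obtain ⟨x, hx⟩ := IsCompact.nonempty_iInter_of_sequence_nonempty_isCompact_isClosed
      (fun n => {x | (P n).pos x = 0}) (fun n x hx => (h.refines n).pos_eq_zero x hx)
      (fun n => ⟨_, ((P n).exists_base (Classical.arbitrary X)).2⟩)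
      ((P 0).pos_locallyConstant.isClopen_fiber 0).isClosed.isCompact
      (fun n => ((P n).pos_locallyConstant.isClopen_fiber 0).isClosed)
    rw [Set.mem_iInter] at hx
    refine ⟨pathAt h x, (isMinPath_pathAt_iff h).2 hx, fun p hp => ?_⟩
    obtain ⟨y, rfl⟩ := surjective_pathAt h p
    rw [isMinPath_pathAt_iff] at hp
    rw [h.separates y x fun n => ⟨(h.refines n).base y x (hp _) (hx _), (hp n).trans (hx n).symm⟩]

theorem isRepresentationOf_towerDiagram [CompactSpace X] :
    (towerDiagram h).IsRepresentationOf T := by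
  refine ⟨isSimple_towerDiagram h, isProperlyOrdered_towerDiagram h, ?_⟩
  let φ := (continuous_pathAt h).homeoOfEquivCompactToT2
    (f := Equiv.ofBijective _ ⟨injective_pathAt h, surjective_pathAt h⟩)
  refine ⟨φ.symm, fun p => ?_⟩
  obtain ⟨x, rfl⟩ := φ.surjective p
  rw [φ.symm_apply_apply, φ.symm_apply_eq]
  exact (OrderedBratteliDiagram.existsUnique_isVershikImage
    (isProperlyOrdered_towerDiagram h) _).unique
    (OrderedBratteliDiagram.isVershikImage_vershikMap _ _) (isVershikImage_pathAt h x)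

end Diagram

/-! ### From recognizable sets of words to tower partitions -/

section Recognizable

variable {A B : Type*}

theorem strictMono_cut {τ : A → List B} (hτ : ∀ a, τ a ≠ []) (y : ℤ → A) :
    StrictMono (cut τ y) :=
  strictMono_int_of_lt_succ fun n => by
    have := List.length_pos_iff.2 (hτ (y n))
    rw [cut_succ]
    omega

theorem cut_shift (τ : A → List B) (y : ℤ → A) (m n : ℤ) :
    cut τ (shift m y) n = cut τ y (m + n) - cut τ y m := by
  induction n using Int.induction_on with
  | zero => simp [cut_zero]
  | succ n ih => rw [cut_succ, ih, ← add_assoc, cut_succ, shift_apply]; ring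
  | pred n ih =>
    have h1 := cut_succ τ (shift m y) (-(n : ℤ) - 1)
    have h2 := cut_succ τ y (m + (-(n : ℤ) - 1))
    rw [shift_apply] at h1
    rw [sub_add_cancel, ih] at h1
    rw [add_assoc, sub_add_cancel] at h2
    omega

theorem IsImage.shift {τ : A → List B} {y : ℤ → A} {z : ℤ → B} (h : IsImage τ y z) (m : ℤ) :
    IsImage τ (shift m y) (shift (cut τ y m) z) := by
  intro n i hi
  have := h (m + n) i hi
  rw [shift_apply, cut_shift]
  refine (congrArg z ?_).trans this
  ring

theorem exists_le_lt_succ_of_strictMono {f : ℤ → ℤ} (hf : StrictMono f) (k : ℤ) :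
    ∃ n, f n ≤ k ∧ k < f (n + 1) := by
  have hm : Monotone fun n => f n - n := monotone_int_of_le_succ fun n => by
    have := hf (lt_add_one n)
    omega
  obtain ⟨n, hn, hmax⟩ := Int.exists_greatest_of_bdd (P := fun n => f n ≤ k)
    ⟨max 0 (k - f 0), fun n hn => by
      rcases le_total 0 n with h | h
      · have := hm h
        dsimp only at this
        omega
      · omega⟩
    ⟨min 0 (k - f 0), by
      have := hm (min_le_left 0 (k - f 0))
      dsimp only at this
      omega⟩
  refine ⟨n, hn, ?_⟩
  by_contra! h
  have := hmax _ h
  omega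

theorem isRepresentation_iff {τ : A → List B} {k : ℤ} {y : ℤ → A} {x : ℤ → B} :
    IsRepresentation τ k y x ↔ IsImage τ y (shift (-k) x) := by
  constructor
  · rintro ⟨z, hz, rfl⟩
    rwa [← shift_add, add_neg_cancel, shift_zero]
  · exact fun h => ⟨_, h, by rw [← shift_add, neg_add_cancel, shift_zero]⟩

/-- The origin of `x` is coordinate `k` of `τ (y)`; shift `y` to the letter whose image covers that
coordinate. -/
theorem IsRepresentation.exists_centered {τ : A → List B} (hτ : ∀ a, τ a ≠ []) {k : ℤ}
    {y : ℤ → A} {x : ℤ → B} (h : IsRepresentation τ k y x) :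
    ∃ k' n, IsCenteredRepresentation τ k' (shift n y) x := by
  obtain ⟨z, hz, rfl⟩ := h
  obtain ⟨n, h1, h2⟩ := exists_le_lt_succ_of_strictMono (strictMono_cut hτ y) k
  rw [cut_succ] at h2
  refine ⟨k - cut τ y n, n, ⟨_, hz.shift n, ?_⟩, by omega, ?_⟩
  · rw [← shift_add, add_sub_cancel]
  · rw [shift_apply, add_zero]
    omega

theorem IsCenteredRepresentation.apply_zero {τ : A → List B} {k : ℕ} {y : ℤ → A} {x : ℤ → B}
    (h : IsCenteredRepresentation τ k y x) (hk : k < (τ (y 0)).length) :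
    x 0 = (τ (y 0))[k] := by
  obtain ⟨⟨z, hz, rfl⟩, -⟩ := h
  have := hz 0 k hk
  rw [cut_zero, zero_add] at this
  rw [shift_apply, add_zero, this]

theorem IsCenteredRepresentation.shift_succ {τ : A → List B} {k : ℤ} {y : ℤ → A} {x : ℤ → B}
    (h : IsCenteredRepresentation τ k y x) (hk : k + 1 < (τ (y 0)).length) :
    IsCenteredRepresentation τ (k + 1) y (shift 1 x) := by
  obtain ⟨⟨z, hz, rfl⟩, h0, -⟩ := h
  exact ⟨⟨z, hz, by rw [← shift_add]⟩, by omega, hk⟩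

theorem IsCenteredRepresentation.shift_next {τ : A → List B} (hτ : ∀ a, τ a ≠ []) {k : ℤ}
    {y : ℤ → A} {x : ℤ → B} (h : IsCenteredRepresentation τ k y x)
    (hk : k + 1 = (τ (y 0)).length) :
    IsCenteredRepresentation τ 0 (shift 1 y) (shift 1 x) := by
  obtain ⟨⟨z, hz, rfl⟩, -, -⟩ := h
  refine ⟨⟨_, hz.shift 1, ?_⟩, le_rfl, ?_⟩
  · have := cut_succ τ y 0
    rw [zero_add, cut_zero, zero_add] at this
    rw [← shift_add, ← shift_add, this, hk, add_zero]
  · exact_mod_cast List.length_pos_iff.2 (hτ _)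

variable [TopologicalSpace A] [DiscreteTopology A]

theorem continuous_cut (τ : A → List B) (n : ℤ) : Continuous fun y => cut τ y n := by
  have h : ∀ j : ℤ, Continuous fun y : ℤ → A => ((τ (y j)).length : ℤ) := fun j =>
    (continuous_of_discreteTopology (f := fun a => ((τ a).length : ℤ))).comp (continuous_apply j)
  exact (continuous_finsetSum _ fun j _ => h j).sub (continuous_finsetSum _ fun j _ => h j)

variable [TopologicalSpace B] [DiscreteTopology B]

theorem isClosed_isImage (τ : A → List B) :
    IsClosed {p : (ℤ → A) × (ℤ → B) | IsImage τ p.1 p.2} := by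
  have hc : ∀ (n : ℤ) (i : ℕ), Continuous fun p : (ℤ → A) × (ℤ → B) =>
      (p.1 n, p.2 (cut τ p.1 n + i)) := fun n i => by
    have he : Continuous fun q : (ℤ → B) × ℤ => q.1 q.2 :=
      continuous_prod_of_discrete_right.2 fun m => continuous_apply m
    exact ((continuous_apply n).comp continuous_fst).prodMk (he.comp
      (continuous_snd.prodMk (((continuous_cut τ n).comp continuous_fst).add continuous_const)))
  have : {p : (ℤ → A) × (ℤ → B) | IsImage τ p.1 p.2} = ⋂ (n : ℤ) (i : ℕ),
      (fun p : (ℤ → A) × (ℤ → B) => (p.1 n, p.2 (cut τ p.1 n + i))) ⁻¹'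
        {q | ∀ hi : i < (τ q.1).length, q.2 = (τ q.1)[i]} := by
    ext p
    simp [IsImage]
  rw [this]
  exact isClosed_iInter fun n => isClosed_iInter fun i => (isClosed_discrete _).preimage (hc n i)

/-- The complement of a preimage is a finite union of closed fibers. -/
theorem isLocallyConstant_of_isClosed_fiber {X ι : Type*} [TopologicalSpace X] [Finite ι]
    {f : X → ι} (h : ∀ i, IsClosed {x | f x = i}) : IsLocallyConstant f := by
  intro s
  rw [← isClosed_compl_iff, ← Set.preimage_compl, ← Set.biUnion_preimage_singleton]
  exact Set.Finite.isClosed_biUnion (Set.toFinite _) fun i _ => h i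

/-- The set is the projection of a closed set of pairs `(y, x)` along the compact space `ℤ → A`. -/
theorem isClosed_exists_isCenteredRepresentation [Finite A] (Y : Subshift A ℤ) (τ : A → List B)
    (k : ℤ) (w : List B) : IsClosed {x | ∃ y ∈ Y.carrier, τ (y 0) = w ∧
      IsCenteredRepresentation τ k y x} := by
  have h1 : IsClosed {p : (ℤ → A) × (ℤ → B) | IsRepresentation τ k p.1 p.2} := by
    simp only [isRepresentation_iff]
    exact (isClosed_isImage τ).preimage
      (continuous_fst.prodMk ((continuous_shift (-k)).comp continuous_snd))
  have h2 : IsClosed {p : (ℤ → A) × (ℤ → B) | τ (p.1 0) = w ∧ 0 ≤ k ∧ k < (τ (p.1 0)).length} :=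
    (isClosed_discrete {a : A | τ a = w ∧ 0 ≤ k ∧ k < (τ a).length}).preimage
      (show Continuous fun p : (ℤ → A) × (ℤ → B) => p.1 0 from
        (continuous_apply 0).comp continuous_fst)
  have := isClosedMap_snd_of_compactSpace _
    (((Y.isClosed.preimage continuous_fst).inter h1).inter h2)
  convert this using 1
  ext x
  constructor
  · rintro ⟨y, hy, h, h', h''⟩
    exact ⟨(y, x), ⟨⟨hy, h'⟩, h, h''⟩, rfl⟩
  · rintro ⟨⟨y, x⟩, ⟨⟨hy, h'⟩, h, h''⟩, rfl⟩
    exact ⟨y, hy, h, h', h''⟩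

/-- A recognizable set of words cuts the points of `X` into its words. -/
theorem IsRecognizableWith.exists_towerPartition [Finite A] {W : Finset (List B)}
    {X : Subshift B ℤ} {Y : Subshift A ℤ} {τ : A → List B} (h : IsRecognizableWith W X Y τ) :
    ∃ P : TowerPartition (shiftHomeo X) W, (∀ w, P.height w = w.1.length) ∧
      ∀ x y, P.SameFloor x y → x.1 0 = y.1 0 := by
  have hW : ∀ a, τ a ∈ W := fun a => by
    have : τ a ∈ (W : Set (List B)) := h.range_eq ▸ Set.mem_range_self a
    exact_mod_cast this
  have hτ : ∀ a, τ a ≠ [] := fun a => h.nonempty_words _ (hW a)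
  have hex : ∀ x : X.carrier, ∃ y ∈ Y.carrier, ∃ k : Fin (τ (y 0)).length,
      IsCenteredRepresentation τ k y x.1 := by
    intro x
    obtain ⟨k, y, hy, hk⟩ := (Set.ext_iff.1 h.carrier_eq x.1).1 x.2
    obtain ⟨k', n, h1⟩ := hk.exists_centered hτ
    obtain ⟨k', rfl⟩ := Int.eq_ofNat_of_zero_le h1.2.1
    exact ⟨_, Y.mapsTo n hy, ⟨k', by exact_mod_cast h1.2.2⟩, h1⟩
  choose y hy k hk using hex
  have huniq : ∀ (x : X.carrier) (k' : ℕ), ∀ y' ∈ Y.carrier,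
      IsCenteredRepresentation τ k' y' x.1 → k x = k' ∧ y x = y' := fun x k' y' hy' h' => by
    have := h.recognizable x.1 _ _ _ (hy x) y' hy' (hk x) h'
    exact ⟨by exact_mod_cast this.1, this.2⟩
  -- The towers are indexed by the word `τ (y 0)` and not by the letter `y 0`: several letters may
  -- have the same image, and only the number of words is bounded.
  let f : X.carrier → Σ w : W, Fin w.1.length := fun x => ⟨⟨τ (y x 0), hW _⟩, k x⟩
  have hf : IsLocallyConstant f := by
    refine isLocallyConstant_of_isClosed_fiber fun ⟨w, i⟩ => ?_
    convert (isClosed_exists_isCenteredRepresentation Y τ i w.1).preimage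
      (continuous_subtype_val (p := (· ∈ X.carrier))) using 1
    ext x
    constructor
    · intro hx
      have hx' : f x = ⟨w, i⟩ := hx
      obtain rfl : (f x).1 = w := congrArg Sigma.fst hx'
      obtain rfl : (f x).2 = i := eq_of_heq (Sigma.ext_iff.1 hx').2
      exact ⟨y x, hy x, rfl, hk x⟩
    · rintro ⟨y', hy', hw, h'⟩
      obtain ⟨h1, rfl⟩ := huniq x i y' hy' h'
      obtain ⟨w, hw'⟩ := w
      dsimp only at hw
      subst hw
      exact Sigma.ext rfl (heq_of_eq (Fin.ext h1))
  have h1 : ∀ x, (k x : ℕ) + 1 < (τ (y x 0)).length →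
      k (shiftHomeo X x) = (k x : ℕ) + 1 ∧ y (shiftHomeo X x) = y x := fun x hx =>
    huniq (shiftHomeo X x) (k x + 1) _ (hy x) (by
      push_cast; exact (hk x).shift_succ (by exact_mod_cast hx))
  refine ⟨{
    height := fun w => w.1.length
    tower := fun x => (f x).1
    pos := fun x => (f x).2
    pos_lt := fun x => (f x).2.2
    tower_locallyConstant := hf.comp Sigma.fst
    pos_locallyConstant := hf.comp fun p => (p.2 : ℕ)
    step_tower := fun x hx => Subtype.ext (congrArg (fun z => τ (z 0)) (h1 x hx).2)
    step_pos := fun x hx => (h1 x hx).1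
    step_top := fun x hx => (huniq (shiftHomeo X x) 0 _ (Y.mapsTo 1 (hy x))
      ((hk x).shift_next hτ (by exact_mod_cast hx))).1 }, fun w => rfl, ?_⟩
  intro x x' hx
  have e1 : τ (y x 0) = τ (y x' 0) := congrArg Subtype.val hx.1
  have e2 : (k x : ℕ) = k x' := hx.2
  rw [(hk x).apply_zero (k x).2, (hk x').apply_zero (k x').2]
  simp only [e1, e2]

end Recognizable

/-! ### Cutting and regluing towers -/

theorem isLocallyConstant_zpow_apply {X ι : Type*} [TopologicalSpace X] {T : X ≃ₜ X} {f : X → ι}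
    (hf : IsLocallyConstant f) {g : X → ℤ} (hg : IsLocallyConstant g) :
    IsLocallyConstant fun x => f ((T ^ g x) x) := by
  refine (IsLocallyConstant.iff_eventually_eq _).2 fun x => ?_
  filter_upwards [(IsLocallyConstant.iff_eventually_eq _).1 hg x,
    ((T ^ g x).continuous.tendsto x).eventually
      ((IsLocallyConstant.iff_eventually_eq _).1 hf ((T ^ g x) x))] with y h1 h2
  rw [h1, h2]

theorem zpow_apply_zpow_apply {X : Type*} [TopologicalSpace X] (T : X ≃ₜ X) (m n : ℤ) (x : X) :
    (T ^ m) ((T ^ n) x) = (T ^ (m + n)) x := by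
  rw [zpow_add]; rfl

theorem zpow_apply_apply {X : Type*} [TopologicalSpace X] (T : X ≃ₜ X) (m : ℤ) (x : X) :
    (T ^ m) (T x) = (T ^ (m + 1)) x := by
  rw [zpow_add, zpow_one]; rfl

theorem apply_zpow_apply {X : Type*} [TopologicalSpace X] (T : X ≃ₜ X) (m : ℤ) (x : X) :
    T ((T ^ m) x) = (T ^ (m + 1)) x := by
  rw [add_comm, zpow_add, zpow_one]; rfl

namespace TowerPartition

variable {X : Type*} [TopologicalSpace X] {T : X ≃ₜ X} {ι : Type*} (P : TowerPartition T ι)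

/-- The tower visited after that of `x`. -/
noncomputable def nextTower (x : X) : ι :=
  P.tower ((T ^ ((P.height (P.tower x) : ℤ) - P.pos x)) x)

/-- The tower visited before that of `x`. -/
noncomputable def prevTower (x : X) : ι :=
  P.tower ((T ^ (-(P.pos x : ℤ) - 1)) x)

theorem nextTower_locallyConstant : IsLocallyConstant P.nextTower :=
  isLocallyConstant_zpow_apply P.tower_locallyConstant
    ((P.tower_locallyConstant.prodMk P.pos_locallyConstant).comp
      fun p : ι × ℕ => (P.height p.1 : ℤ) - p.2)

theorem prevTower_locallyConstant : IsLocallyConstant P.prevTower :=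
  isLocallyConstant_zpow_apply P.tower_locallyConstant
    (P.pos_locallyConstant.comp fun p : ℕ => -(p : ℤ) - 1)

variable {P}

theorem nextTower_apply {x : X} (h : P.pos x + 1 < P.height (P.tower x)) :
    P.nextTower (T x) = P.nextTower x := by
  unfold nextTower
  rw [P.step_tower x h, P.step_pos x h, zpow_apply_apply]
  congr 3
  push_cast
  ring

theorem prevTower_apply {x : X} (h : P.pos x + 1 < P.height (P.tower x)) :
    P.prevTower (T x) = P.prevTower x := by
  unfold prevTower
  rw [P.step_pos x h, zpow_apply_apply]
  congr 3
  push_cast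
  ring

theorem nextTower_of_isTop {x : X} (h : P.IsTop x) : P.nextTower x = P.tower (T x) := by
  unfold nextTower
  rw [← h]
  simp

theorem prevTower_apply_of_isTop {x : X} (h : P.IsTop x) : P.prevTower (T x) = P.tower x := by
  unfold prevTower
  rw [P.step_top x h, zpow_apply_apply]
  simp

theorem pos_nextTower (x : X) :
    P.pos ((T ^ ((P.height (P.tower x) : ℤ) - P.pos x)) x) = 0 := by
  obtain ⟨j, hj⟩ := Nat.exists_eq_add_of_lt (P.pos_lt x)
  obtain ⟨h1, h2⟩ := P.forward x j (by omega)
  have := P.step_top ((T ^ (j : ℤ)) x) (by rw [h1, h2]; omega)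
  rw [apply_zpow_apply] at this
  rw [hj]
  convert this using 4
  push_cast
  ring

variable (P) in
/-- Cut each tower `t` at its floor `c t`: the new towers go from the cut of a tower to the cut of
the next tower, and are indexed by pairs of towers. -/
noncomputable def recut (c : ι → ℕ) (hc : ∀ t, 1 ≤ c t) (hc' : ∀ t, c t < P.height t) :
    TowerPartition T (ι × ι) where
  height p := P.height p.1 - c p.1 + c p.2
  tower x := if c (P.tower x) ≤ P.pos x then (P.tower x, P.nextTower x)
    else (P.prevTower x, P.tower x)
  pos x := if c (P.tower x) ≤ P.pos x then P.pos x - c (P.tower x)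
    else P.pos x + (P.height (P.prevTower x) - c (P.prevTower x))
  pos_lt x := by
    have h1 := P.pos_lt x
    have h2 := hc (P.nextTower x)
    split_ifs <;> dsimp only <;> omega
  tower_locallyConstant := (((P.tower_locallyConstant.prodMk P.pos_locallyConstant).prodMk
    (P.nextTower_locallyConstant.prodMk P.prevTower_locallyConstant))).comp
      fun q : (ι × ℕ) × (ι × ι) => if c q.1.1 ≤ q.1.2 then (q.1.1, q.2.1) else (q.2.2, q.1.1)
  pos_locallyConstant := (((P.tower_locallyConstant.prodMk P.pos_locallyConstant).prodMk
    P.prevTower_locallyConstant)).comp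
      fun q : (ι × ℕ) × ι => if c q.1.1 ≤ q.1.2 then q.1.2 - c q.1.1
        else q.1.2 + (P.height q.2 - c q.2)
  step_tower x hx := by
    rcases P.isTop_or_lt x with h | h
    -- Since `1 ≤ c`, the base of the next tower lies below its cut, so crossing a top of `P` does
    -- not leave the new tower.
    · have h1 := hc (P.tower (T x))
      have h2 : c (P.tower x) ≤ P.pos x := by
        have := hc' (P.tower x); unfold IsTop at h; omega
      rw [P.step_top x h, if_pos h2, if_neg (by omega), prevTower_apply_of_isTop h,
        nextTower_of_isTop h]
    · rw [P.step_tower x h, P.step_pos x h, nextTower_apply h, prevTower_apply h]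
      split_ifs at hx ⊢ <;> first | rfl | (exfalso; dsimp only at *; omega)
  step_pos x hx := by
    rcases P.isTop_or_lt x with h | h
    · have h1 := hc (P.tower (T x))
      have h2 : c (P.tower x) ≤ P.pos x := by
        have := hc' (P.tower x); unfold IsTop at h; omega
      rw [P.step_top x h, if_pos h2, if_neg (by omega), prevTower_apply_of_isTop h]
      unfold IsTop at h
      omega
    · rw [P.step_tower x h, P.step_pos x h, prevTower_apply h]
      split_ifs at hx ⊢ <;> dsimp only at * <;> omega
  step_top x hx := by
    rcases P.isTop_or_lt x with h | h
    · have h1 := hc (P.tower (T x))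
      have h2 : c (P.tower x) ≤ P.pos x := by
        have := hc' (P.tower x); unfold IsTop at h; omega
      rw [if_pos h2, if_pos h2, nextTower_of_isTop h] at hx
      unfold IsTop at h
      dsimp only at hx
      have := hc (P.nextTower x)
      omega
    · have h3 := hc (P.nextTower x)
      have h4 := hc' (P.prevTower x)
      rw [P.step_tower x h, P.step_pos x h, prevTower_apply h]
      split_ifs at hx ⊢ <;> dsimp only at * <;> omega

variable {c : ι → ℕ} (hc : ∀ t, 1 ≤ c t) (hc' : ∀ t, c t < P.height t)

theorem recut_base {x : X} (hx : (P.recut c hc hc').pos x = 0) :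
    P.pos x = c (P.tower x) ∧ (P.recut c hc hc').tower x = (P.tower x, P.nextTower x) := by
  dsimp only [recut] at hx ⊢
  have := hc' (P.prevTower x)
  split_ifs at hx ⊢
  · exact ⟨by omega, rfl⟩
  · omega

/-- A new tower indexed by `(s, t)` lies inside a passage through all of `s` and then all of `t`,
and this passage is known from the index. The cuts leave a margin `M` at the bottom of `s` and at
the top of `t`, so a window of radius `M` around any floor of the new tower stays within the
passage. -/
theorem recut_sameFloor_zpow {M : ℕ} (hM : ∀ t, M ≤ c t) (hM' : ∀ t, c t + M < P.height t)
    {x y : X} (h : (P.recut c hc hc').SameFloor x y) {i : ℤ} (hi : |i| ≤ M) :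
    P.SameFloor ((T ^ i) x) ((T ^ i) y) := by
  set Q := P.recut c hc hc' with hQ
  obtain ⟨hx1, hx2⟩ := Q.exists_base x
  obtain ⟨hy1, hy2⟩ := Q.exists_base y
  obtain ⟨hx3, hx4⟩ := recut_base hc hc' hx2
  obtain ⟨hy3, hy4⟩ := recut_base hc hc' hy2
  have hq : Q.pos x < P.height (Q.tower x).1 - c (Q.tower x).1 + c (Q.tower x).2 := Q.pos_lt x
  rw [← hQ, hx1] at hx4
  rw [← hQ, hy1, ← h.1, hx4] at hy4
  rw [hx4] at hq
  dsimp only at hq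
  have ex : (T ^ i) x = (T ^ (i + Q.pos x)) ((T ^ (-(Q.pos x : ℤ))) x) := by
    rw [zpow_apply_zpow_apply, add_neg_cancel_right]
  have ey : (T ^ i) y = (T ^ (i + Q.pos x)) ((T ^ (-(Q.pos y : ℤ))) y) := by
    rw [zpow_apply_zpow_apply, h.2, add_neg_cancel_right]
  rw [ex, ey]
  generalize (T ^ (-(Q.pos x : ℤ))) x = x0 at *
  generalize (T ^ (-(Q.pos y : ℤ))) y = y0 at *
  rw [Prod.mk.injEq] at hy4
  obtain ⟨h1, h2⟩ := hy4
  have h3 : P.pos x0 = P.pos y0 := by rw [hx3, hy3, h1]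
  have a1 := hM (P.tower x0)
  have a2 := hM' (P.tower x0)
  have a3 := hM' (P.nextTower x0)
  obtain ⟨hi1, hi2⟩ := abs_le.1 hi
  -- With `x0` and `y0` at the cut of the first tower, the target lies either in that tower or,
  -- after stepping to the base of the next one, in the second.
  rcases lt_or_ge (P.pos x0 + (i + Q.pos x)) (P.height (P.tower x0)) with hlt | hge
  · exact SameFloor.zpow ⟨h1, h3⟩ _ (by omega) hlt
  · have e : ∀ z, (T ^ (i + Q.pos x)) z = (T ^ (i + Q.pos x - ((P.height (P.tower x0) : ℤ) -
        P.pos x0))) ((T ^ ((P.height (P.tower x0) : ℤ) - P.pos x0)) z) := fun z => by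
      rw [zpow_apply_zpow_apply, sub_add_cancel]
    rw [e x0, e y0]
    have b1 := pos_nextTower (P := P) x0
    have b2 := pos_nextTower (P := P) y0
    have h2' := h2
    unfold nextTower at h2'
    rw [← h1, ← h3] at b2 h2'
    refine SameFloor.zpow ⟨h2', b1.trans b2.symm⟩ _ (by rw [b1]; omega) ?_
    rw [b1]
    change _ < (P.height (P.nextTower x0) : ℤ)
    omega

/-- Restrict to the non-empty towers, and number them. -/
theorem exists_surjective_reindex [Finite ι] (P : TowerPartition T ι) :
    ∃ d ≤ Nat.card ι, ∃ (Q : TowerPartition T (Fin d)) (f : Fin d → ι),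
      Function.Surjective Q.tower ∧ (∀ t, Q.height t = P.height (f t)) ∧
      (∀ x y, Q.SameFloor x y ↔ P.SameFloor x y) ∧ ∀ x, Q.pos x = P.pos x := by
  obtain ⟨d, ⟨e⟩⟩ := Finite.exists_equiv_fin (Set.range P.tower)
  have hf : ∀ x, (e.symm (e ⟨P.tower x, x, rfl⟩)).1 = P.tower x := fun x => by simp
  refine ⟨d, ?_, {
    height := fun t => P.height (e.symm t).1
    tower := fun x => e ⟨P.tower x, x, rfl⟩
    pos := P.pos
    pos_lt := fun x => by rw [hf]; exact P.pos_lt x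
    tower_locallyConstant := (IsLocallyConstant.desc (fun x => e ⟨P.tower x, x, rfl⟩)
      (fun t => (e.symm t).1) (by convert P.tower_locallyConstant using 1; ext x; exact hf x)
      (Subtype.val_injective.comp e.symm.injective))
    pos_locallyConstant := P.pos_locallyConstant
    step_tower := fun x hx => by
      rw [hf] at hx
      simp only [P.step_tower x hx]
    step_pos := fun x hx => P.step_pos x (by rwa [hf] at hx)
    step_top := fun x hx => P.step_top x (by rwa [hf] at hx) }, fun t => (e.symm t).1,
    ?_, fun t => rfl, fun x y => ?_, fun x => rfl⟩
  · rw [← Nat.card_fin d, ← Nat.card_congr e]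
    exact Finite.card_subtype_le _
  · intro t
    obtain ⟨⟨_, x, rfl⟩, rfl⟩ := e.surjective t
    exact ⟨x, rfl⟩
  · exact and_congr (e.injective.eq_iff.trans Subtype.ext_iff) Iff.rfl

end TowerPartition

/-! ### Bounded return times and the choice of cuts -/

theorem IsMinimalSystem.exists_return {X : Type*} [TopologicalSpace X] [CompactSpace X]
    {T : X ≃ₜ X} (hT : IsMinimalSystem T) {U : Set X} (hU : IsOpen U) (hne : U.Nonempty) :
    ∃ R : ℕ, ∀ x, ∃ j < R, (T ^ (j : ℤ)) x ∈ U := by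
  obtain ⟨s, hs⟩ := isCompact_univ.elim_finite_subcover (fun n : ℤ => (T ^ n) ⁻¹' U)
    (fun n => hU.preimage (T ^ n).continuous) fun x _ => by
      obtain ⟨_, hx, n, rfl⟩ := (hT x).inter_open_nonempty U hU hne
      exact Set.mem_iUnion.2 ⟨n, hx⟩
  -- Let `m` bound the absolute values of the times in the finite cover. Applying the cover at `T ^
  -- m x` turns a time `n` into `n + m`, which lies between `0` and `2 * m`.
  refine ⟨2 * s.sup Int.natAbs + 1, fun x => ?_⟩
  obtain ⟨n, hn, hx⟩ := Set.mem_iUnion₂.1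
    (hs (Set.mem_univ ((T ^ ((s.sup Int.natAbs : ℕ) : ℤ)) x)))
  have := Finset.le_sup (f := Int.natAbs) hn
  refine ⟨(n + s.sup Int.natAbs).toNat, by omega, ?_⟩
  rw [Int.toNat_of_nonneg (by omega), ← zpow_apply_zpow_apply]
  exact hx

/-- Cut long towers inside a set which is visited often. -/
theorem TowerPartition.exists_cut {X : Type*} [TopologicalSpace X] {T : X ≃ₜ X} {ι : Type*}
    (P : TowerPartition T ι) {C : Set X} {M R : ℕ}
    (hC : ∀ x y, (∀ i : ℤ, |i| ≤ M → P.SameFloor ((T ^ i) x) ((T ^ i) y)) → x ∈ C → y ∈ C)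
    (hR : ∀ x, ∃ j < R, (T ^ (j : ℤ)) x ∈ C) (hP : ∀ t, 2 * M + R < P.height t) :
    ∃ c : ι → ℕ, (∀ t, M ≤ c t) ∧ (∀ t, c t + M < P.height t) ∧
      ∀ x, P.pos x = c (P.tower x) → x ∈ C := by
  have : ∀ t, ∃ c, M ≤ c ∧ c + M < P.height t ∧ ∀ x, P.tower x = t → P.pos x = c → x ∈ C := by
    intro t
    have ht := hP t
    by_cases hx : ∃ x, P.tower x = t
    · obtain ⟨x, hx1, hx2⟩ := P.exists_tower_pos (j := M) hx (by omega)
      obtain ⟨j, hj, hj'⟩ := hR x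
      obtain ⟨h1, h2⟩ := P.forward x j (by rw [hx1]; omega)
      refine ⟨M + j, by omega, by omega, fun y hy1 hy2 => hC _ y (fun i hi => ?_) hj'⟩
      have hs : P.SameFloor ((T ^ (j : ℤ)) x) y :=
        ⟨by rw [h1, hx1, hy1], by rw [h2, hx2, hy2]⟩
      obtain ⟨hi1, hi2⟩ := abs_le.1 hi
      exact hs.zpow i (by omega) (by rw [h1, hx1]; omega)
    · exact ⟨M, le_rfl, by omega, fun x h => absurd ⟨x, h⟩ hx⟩
  choose c h1 h2 h3 using this
  exact ⟨c, h1, h2, fun x hx => h3 _ x rfl hx⟩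

/-! ### Subshifts with finite `K`: construction of the nested sequence -/

section Subshift

variable {B : Type*} [TopologicalSpace B]

theorem shiftHomeo_zpow_apply (X : Subshift B ℤ) (i : ℤ) (x : X.carrier) :
    ((shiftHomeo X ^ i) x).1 = shift i x.1 := by
  induction i using Int.induction_on with
  | zero => simp
  | succ n ih => rw [← apply_zpow_apply, add_comm, add_comm, shift_add, ← ih]; rfl
  | pred n ih =>
    rw [sub_eq_add_neg, shift_add, ← ih, add_comm, zpow_add, zpow_neg_one]; rfl

variable {X : Subshift B ℤ}

theorem exists_recognizable {k : ℕ} (hk : K X = k) (N : ℕ) :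
    ∃ W : Finset (List B), (∀ w ∈ W, N ≤ w.length) ∧ IsRecognizable W X ∧ W.card ≤ k := by
  have h1 : minRecognizable X N < (k + 1 : ℕ) :=
    (le_iSup (minRecognizable X) N).trans_lt (by
      change K X < _
      rw [hk]
      exact_mod_cast k.lt_succ_self)
  obtain ⟨_, ⟨W, hW, hrec, rfl⟩, hlt⟩ := sInf_lt_iff.1 h1
  refine ⟨W, fun w hw => ?_, hrec, Nat.lt_succ_iff.1 (by exact_mod_cast hlt)⟩
  obtain ⟨n, hn, x, -, m, rfl⟩ := Set.mem_iUnion₂.1 (hW hw)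
  simpa [wordAt] using hn

variable [DiscreteTopology B]

theorem exists_long_towerPartition {k : ℕ} (hk : K X = k) (N : ℕ) :
    ∃ W : Finset (List B), W.card ≤ k ∧ ∃ P : TowerPartition (shiftHomeo X) W,
      (∀ w, N ≤ P.height w) ∧ ∀ x y, P.SameFloor x y → x.1 0 = y.1 0 := by
  obtain ⟨W, hW, ⟨A, _, _, _, Y, τ, h⟩, hc⟩ := exists_recognizable hk N
  obtain ⟨P, h1, h2⟩ := h.exists_towerPartition
  exact ⟨W, hc, P, fun w => by rw [h1]; exact hW _ w.2, h2⟩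

variable [Finite B]

instance (X : Subshift B ℤ) : CompactSpace X.carrier :=
  isCompact_iff_compactSpace.1 X.isClosed.isCompact

/-- Locally constant functions on a subshift depend on finitely many coordinates. -/
theorem exists_window {ι : Type*} {f : X.carrier → ι}
    (hf : IsLocallyConstant f) :
    ∃ M : ℕ, ∀ x y : X.carrier, (∀ i : ℤ, |i| ≤ M → x.1 i = y.1 i) → f x = f y := by
  by_contra! hcon
  have hcl : IsClosed {p : X.carrier × X.carrier | f p.1 ≠ f p.2} := by
    have : IsLocallyConstant fun p : X.carrier × X.carrier => (f p.1, f p.2) :=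
      (hf.comp_continuous continuous_fst).prodMk (hf.comp_continuous continuous_snd)
    exact isOpen_compl_iff.1 (this {q | q.1 ≠ q.2}ᶜ)
  have hco : ∀ i : ℤ, IsClosed {p : X.carrier × X.carrier | p.1.1 i = p.2.1 i} := fun i =>
    isClosed_eq ((continuous_apply i).comp (continuous_subtype_val.comp continuous_fst))
      ((continuous_apply i).comp (continuous_subtype_val.comp continuous_snd))
  have hclosed : ∀ M : ℕ, IsClosed ({p : X.carrier × X.carrier | f p.1 ≠ f p.2} ∩
      ⋂ (i : ℤ) (_ : |i| ≤ M), {p | p.1.1 i = p.2.1 i}) := fun M =>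
    hcl.inter (isClosed_iInter fun i => isClosed_iInter fun _ => hco i)
  -- A limit of pairs that agree on larger and larger windows but have different values of `f` would
  -- be a pair of equal points with different values.
  obtain ⟨p, hp⟩ := IsCompact.nonempty_iInter_of_sequence_nonempty_isCompact_isClosed _
    (fun M => Set.inter_subset_inter_right _ (Set.iInter_mono fun i =>
      Set.iInter_mono' fun h => ⟨by push_cast; omega, le_rfl⟩))
    (fun M => by
      obtain ⟨x, y, h1, h2⟩ := hcon M
      exact ⟨(x, y), h2, by simpa using h1⟩) (hclosed 0).isCompact hclosed
  rw [Set.mem_iInter] at hp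
  refine (hp 0).1 (congrArg f (Subtype.ext (funext fun i => ?_)))
  have := (hp i.natAbs).2
  simp only [Set.mem_iInter] at this
  exact this i (by simp)

/-- The inductive step, and the source of the square: the towers come from at most `k` words, and
regluing indexes the new ones by pairs of words. -/
theorem exists_refines [Nonempty X.carrier] (hmin : IsMinimalSystem (shiftHomeo X)) {k : ℕ}
    (hk : K X = k) {ι : Type*} [Finite ι] (P : TowerPartition (shiftHomeo X) ι)
    (hP : Function.Surjective P.tower) (n : ℕ) :
    ∃ d ≤ k ^ 2, ∃ Q : TowerPartition (shiftHomeo X) (Fin d), Function.Surjective Q.tower ∧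
      Q.Refines P ∧ ∀ x y, Q.SameFloor x y → ∀ i : ℤ, |i| ≤ n → x.1 i = y.1 i := by
  let T := shiftHomeo X
  obtain ⟨x₀, hx₀⟩ : ∃ x, P.pos x = 0 :=
    ⟨_, (P.exists_base (Classical.arbitrary X.carrier)).2⟩
  -- The floor of `x` controls the new base, and that of `T⁻¹ x` controls the new tops, which are
  -- the preimages of the base.
  let g : X.carrier → (ι × ℕ) × (ι × ℕ) := fun x =>
    ((P.tower x, P.pos x), (P.tower (T.symm x), P.pos (T.symm x)))
  have hg : IsLocallyConstant g :=
    (P.tower_locallyConstant.prodMk P.pos_locallyConstant).prodMk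
      ((P.tower_locallyConstant.comp_continuous T.symm.continuous).prodMk
        (P.pos_locallyConstant.comp_continuous T.symm.continuous))
  let C : Set X.carrier := {x | g x = g x₀}
  obtain ⟨M₁, hM₁⟩ := exists_window hg
  obtain ⟨R, hR⟩ := hmin.exists_return (hg.isOpen_fiber (g x₀)) ⟨x₀, rfl⟩
  choose R' hR' using fun t => hmin.exists_return (P.tower_locallyConstant.isOpen_fiber t) (hP t)
  obtain ⟨R₁, hR₁⟩ := (Set.finite_range R').bddAbove
  -- The radius `M` must determine `g` (`M₁`), separate the required coordinates (`n`), make the new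
  -- towers tall enough to visit every tower of `P` (`R₁`), and make the cuts positive.
  obtain ⟨M, hM1, hMn, hMR, hM0⟩ : ∃ M, M₁ ≤ M ∧ n ≤ M ∧ R₁ ≤ M ∧ 1 ≤ M :=
    ⟨M₁ + n + R₁ + 1, by omega, by omega, by omega, by omega⟩
  obtain ⟨W, hW, L, hL, hL0⟩ := exists_long_towerPartition hk (2 * M + R + 1)
  have hwin : ∀ x y, (∀ i : ℤ, |i| ≤ M → L.SameFloor ((T ^ i) x) ((T ^ i) y)) →
      ∀ i : ℤ, |i| ≤ M → x.1 i = y.1 i := fun x y h i hi => by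
    have := hL0 _ _ (h i hi)
    rw [shiftHomeo_zpow_apply, shiftHomeo_zpow_apply] at this
    simpa [shift_apply] using this
  have hgwin : ∀ x y, (∀ i : ℤ, |i| ≤ M → L.SameFloor ((T ^ i) x) ((T ^ i) y)) → g x = g y :=
    fun x y h => hM₁ x y fun i hi => hwin x y h i (by omega)
  obtain ⟨c, hc1, hc2, hc3⟩ := L.exists_cut (C := C) (fun x y h hx => (hgwin x y h).symm.trans hx)
    hR fun t => by have := hL t; omega
  let Q₀ := L.recut c (fun t => hM0.trans (hc1 t)) (fun t => by have := hc2 t; omega)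
  obtain ⟨d, hd, Q, f, hQ, hQh, hQs, hQp⟩ := Q₀.exists_surjective_reindex
  have hQw : ∀ x y, Q.SameFloor x y →
      ∀ i : ℤ, |i| ≤ M → L.SameFloor ((T ^ i) x) ((T ^ i) y) := fun x y h i hi =>
    TowerPartition.recut_sameFloor_zpow _ _ hc1 hc2 ((hQs x y).1 h) hi
  have hbase : ∀ x, Q.pos x = 0 → g x = g x₀ := fun x hx =>
    hc3 x (TowerPartition.recut_base _ _ ((hQp x).symm.trans hx)).1
  have htop : ∀ x, Q.IsTop x → P.tower x = P.tower (T.symm x₀) := fun x hx => by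
    have := congrArg (fun q => q.2.1) (hbase _ (Q.step_top x hx))
    dsimp only [g] at this
    rwa [T.symm_apply_apply] at this
  have hheight : ∀ t, M ≤ Q.height t := fun t => by
    rw [hQh]
    have := hc1 (f t).2
    change M ≤ L.height (f t).1 - c (f t).1 + c (f t).2
    omega
  refine ⟨d, hd.trans ?_, Q, hQ, ⟨fun x y h => ?_, fun x hx => ?_, fun x y hx hy => ?_,
    fun x y hx hy => (htop x hx).trans (htop y hy).symm, fun t s => ?_⟩,
    fun x y h i hi => hwin x y (hQw x y h) i (by omega)⟩
  · rw [Nat.card_prod, pow_two]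
    have : Nat.card W ≤ k := by simpa using hW
    exact Nat.mul_le_mul this this
  · have := congrArg Prod.fst (hgwin x y (hQw x y h))
    exact ⟨congrArg Prod.fst this, congrArg Prod.snd this⟩
  · exact (congrArg (fun q => q.1.2) (hbase x hx)).trans hx₀
  · exact congrArg (fun q => q.1.1) ((hbase x hx).trans (hbase y hy).symm)
  -- From its base, the new tower `s` has at least `M` floors, and tower `t` of `P` is visited
  -- within `R' t ≤ R₁ ≤ M` steps.
  · have hs := hheight s
    obtain ⟨x, hx1, hx2⟩ := Q.exists_tower_pos (hQ s) (j := 0) (by omega)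
    obtain ⟨j, hj, hjx⟩ := hR' t x
    have : R' t ≤ R₁ := hR₁ ⟨t, rfl⟩
    exact ⟨_, (Q.forward x j (by rw [hx1]; omega)).1.trans hx1, hjx⟩

/-- The partition into one tower with one floor. -/
def trivialTowerPartition {X : Type*} [TopologicalSpace X] (T : X ≃ₜ X) :
    TowerPartition T (Fin 1) where
  height _ := 1
  tower _ := 0
  pos _ := 0
  pos_lt _ := Nat.one_pos
  tower_locallyConstant := IsLocallyConstant.const _
  pos_locallyConstant := IsLocallyConstant.const _
  step_tower _ _ := rfl
  step_pos _ h := by omega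
  step_top _ _ := rfl

theorem exists_isNested [Nonempty X.carrier] (hmin : IsMinimalSystem (shiftHomeo X)) {k : ℕ}
    (hk : K X = k) : ∃ (d : ℕ → ℕ) (P : ∀ n, TowerPartition (shiftHomeo X) (Fin (d n))),
      IsNested P ∧ d 0 = 1 ∧ ∀ n, d (n + 1) ≤ k ^ 2 := by
  let S := Σ d : ℕ, {P : TowerPartition (shiftHomeo X) (Fin d) // Function.Surjective P.tower}
  have hstep : ∀ (n : ℕ) (P : S), ∃ Q : S, Q.1 ≤ k ^ 2 ∧ Q.2.1.Refines P.2.1 ∧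
      ∀ x y, Q.2.1.SameFloor x y → ∀ i : ℤ, |i| ≤ n → x.1 i = y.1 i := fun n P => by
    obtain ⟨d, hd, Q, h1, h2⟩ := exists_refines hmin hk P.2.1 P.2.2 n
    exact ⟨⟨d, Q, h1⟩, hd, h2⟩
  choose F hF1 hF2 hF3 using hstep
  let P : ℕ → S := fun n => Nat.rec ⟨1, trivialTowerPartition _, fun t =>
    ⟨Classical.arbitrary _, Subsingleton.elim _ _⟩⟩ F n
  refine ⟨fun n => (P n).1, fun n => (P n).2.1, ⟨fun n => (P n).2.2, fun t => rfl,
    inferInstanceAs (Subsingleton (Fin 1)), fun n => hF2 n (P n), fun x y h => ?_⟩,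
    rfl, fun n => hF1 n (P n)⟩
  refine Subtype.ext (funext fun i => ?_)
  -- The partition of level `m + 1` determines the coordinates in `[-m, m]`; take `m = |i|`.
  exact hF3 i.natAbs (P i.natAbs) x y (h (i.natAbs + 1)) i (by simp)

end Subshift

end TopRank

theorem mainTheorem4 {B : Type*} [Finite B] [TopologicalSpace B] [DiscreteTopology B]
    (X : SymbolicDynamics.FullShift.Subshift B ℤ) (hne : X.carrier.Nonempty)
    (hmin : TopRank.IsMinimalSystem (TopRank.shiftHomeo X)) :
    TopRank.topologicalRank (TopRank.shiftHomeo X) ≤ TopRank.K X ^ 2 := by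
  have : Nonempty X.carrier := hne.to_subtype
  rcases eq_or_ne (TopRank.K X) ⊤ with hK | hK
  · rw [hK]
    simp
  obtain ⟨k, hk⟩ := ENat.ne_top_iff_exists.1 hK
  obtain ⟨d, P, hP, hd0, hd⟩ := TopRank.exists_isNested hmin hk.symm
  rw [← hk]
  refine sInf_le ⟨k ^ 2, by push_cast; rfl, TopRank.towerDiagram hP,
    TopRank.isRepresentationOf_towerDiagram hP, fun n => ?_⟩
  change Nat.card (Fin (d n)) ≤ k ^ 2
  rw [Nat.card_fin]
  obtain _ | n := n
  -- The root level has one vertex, so `1 ≤ k ^ 2` is needed; it holds because level `1` is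
  -- non-empty and has at most `k ^ 2` towers.
  · have : 0 < d 1 := Fin.pos ((P 1).tower ⟨_, hne.some_mem⟩)
    have := hd 0
    rw [zero_add] at this
    omega
  · exact hd n
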